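/- Let $S$ be a nonempty finite set and $\mathcal B$ a building set on $S$: a collection of nonempty subsets of $S$ containing all singletons and such that $I,J\in\mathcal B$, $I\cap J\neq\emptyset$ imply $I\cup J\in\mathcal B$. Let $\mathcal B_{\max}$ be the set of inclusion-maximal elements of $\mathcal B$ (the components). A subset $N\subset\mathcal B\setminus\mathcal B_{\max}$ is nested if for all $k\ge 2$ and $I_1,\dots,I_k\in N$, none of which contains another, $I_1\cup\dots\cup I_k\notin\mathcal B$. For $I\subset S$ put $e_I=\sum_{i\in I}e_i\in\mathbb R^S$, and let $V=\mathbb R^S/\operatorname{span}\{e_C: C\in\mathcal B_{\max}\}$, so that $V^*=\{x\in\mathbb R^S:\sum_{i\in C}x_i=0 \text{ for all } C\in\mathcal B_{\max}\}$. The nested fan $\Delta(\mathcal B)$ in $V$ consists of the cones generated by the images of the vectors $e_I$, $I\in N$, for all nested sets $N$. The nested polytope $\Pi(\mathcal B)$ is a convex polytope in $V^*$ whose normal fan is $\Delta(\mathcal B)$, i.e. such that the cones of $\Delta(\mathcal B)$ are exactly the cones $$\{v\in V:\langle v,\varphi\rangle=\max_{\psi\in\Pi(\mathcal B)}\langle v,\psi\rangle\text{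 for all }\varphi\in\Sigma\},$$ where $\Sigma$ runs over the nonempty faces of $\Pi(\mathcal B)$. Its explicit realization is the set of all $x\in\mathbb R^S$ with $$\sum_{i\in C}x_i=0\quad(C\in\mathcal B_{\max}),\qquad \sum_{i\in I}x_i\le |I|\,(2^{|C|-1}-2^{|I|-1})\quad(I\in\mathcal B\setminus\mathcal B_{\max},\ I\subset C\in\mathcal B_{\max}).$$ Proposition 6.4. Let $\Pi(\mathcal B)$ be either this explicit realization or any convex polytope in $V^*$ with normal fan $\Delta(\mathcal B)$. Then every two-dimensional face of $\Pi(\mathcal B)$ (possibly $\Pi(\mathcal B)$ itself) is a $d$-gon with $d\in\{3,4,5,6\}$. If moreover $\mathcal B$ is graphical, i.e. $\mathcal B$ is the set of all nonempty subsets of $S$ that induce a connected subgraph of $\Gamma$, for some graph $\Gamma$ with vertex set $S$, then $d\in\{4,5,6\}$. -/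

import Mathlib

/-- A building set on `S`: a collection of nonempty subsets of `S` that contains all singletons and
contains the union of any two of its members that meet. -/
structure BuildingSet (S : Type*) [DecidableEq S] where
  sets : Set (Finset S)
  nonempty_of_mem : ∀ I ∈ sets, I.Nonempty
  union_mem : ∀ I ∈ sets, ∀ J ∈ sets, (I ∩ J).Nonempty → I ∪ J ∈ sets
  singleton_mem : ∀ i : S, {i} ∈ sets

/-- The building set of a graph: the nonempty vertex sets inducing a connected subgraph
(`Connected` includes nonemptiness). -/
def graphicalBuilding {S : Type*} [DecidableEq S] (Γ : SimpleGraph S) : BuildingSet S where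
  sets := {C | (Γ.induce (C : Set S)).Connected}
  nonempty_of_mem I hI := by
    obtain ⟨⟨x, hx⟩⟩ := hI.nonempty
    exact ⟨x, by simpa using hx⟩
  union_mem I hI J hJ h := by
    have h' : ((I : Set S) ∩ (J : Set S)).Nonempty := by
      rw [← Finset.coe_inter]
      exact Finset.coe_nonempty.mpr h
    have := SimpleGraph.induce_union_connected hI.preconnected hJ.preconnected h'
    rw [← Finset.coe_union] at this
    exact this
  singleton_mem i := by
    have : Subsingleton ((({i} : Finset S) : Set S)) := by
      rw [Finset.coe_singleton]
      infer_instance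
    have : Nonempty ((({i} : Finset S) : Set S)) := ⟨⟨i, by simp⟩⟩
    exact ⟨SimpleGraph.Preconnected.of_subsingleton⟩

namespace BuildingSet

variable {S : Type*} [Fintype S] [DecidableEq S] (B : BuildingSet S)

/-- The `B`-components: the members of `B` that are maximal under inclusion. -/
def components : Set (Finset S) := {C | Maximal (· ∈ B.sets) C}

/-- `N` is a nested set: its elements are members of `B` that are not components, and the union of
any two or more pairwise incomparable elements of `N` is not in `B`. -/
def IsNested (N : Finset (Finset S)) : Prop :=
  (∀ I ∈ N, I ∈ B.sets ∧ I ∉ B.components) ∧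
  ∀ T : Finset (Finset S), T ⊆ N → 2 ≤ T.card → IsAntichain (· ⊆ ·) (T : Set (Finset S)) →
    T.sup id ∉ B.sets

/-- The vector `e_I ∈ ℝ^S`, the sum of the basis vectors `e_i` for `i ∈ I`. -/
def indicatorVec (I : Finset S) : S → ℝ := fun i => if i ∈ I then 1 else 0

/-- The linear span of the vectors `e_C` for the components `C`. -/
def componentSpan : Submodule ℝ (S → ℝ) :=
  Submodule.span ℝ (indicatorVec '' B.components)

/-- The ambient space of the nested fan, `V = ℝ^S / span {e_C}`. -/
abbrev V : Type _ := (S → ℝ) ⧸ B.componentSpan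

/-- The cone in `V` generated by the images of the vectors `e_I` for `I ∈ N`. -/
def nestedCone (N : Finset (Finset S)) : Set B.V :=
  {w | ∃ c : Finset S → ℝ, (∀ I ∈ N, 0 ≤ c I) ∧
    w = ∑ I ∈ N, c I • B.componentSpan.mkQ (indicatorVec I)}

/-- The nested fan: the set of the cones generated by the nested sets. -/
def nestedFan : Set (Set B.V) := {K | ∃ N, B.IsNested N ∧ K = B.nestedCone N}

/-- The dual space of `V`, identified with the space of the real tuples whose coordinates sum to
zero over every component. -/
def dualSpace : Submodule ℝ (S → ℝ) where
  carrier := {x | ∀ C ∈ B.components, ∑ i ∈ C, x i = 0}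
  add_mem' hx hy C hC := by simp [Finset.sum_add_distrib, hx C hC, hy C hC]
  zero_mem' C _ := by simp
  smul_mem' a x hx C hC := by simp [← Finset.mul_sum, hx C hC]

/-- The normal cone in `V` of a subset `F` of `P ⊆ V*`: the classes of those `v` whose pairing with
the points of `P` attains its maximum at every point of `F`. (For `P ⊆ V*` the pairing depends only
on the class of `v`.) -/
def normalCone (P F : Set (S → ℝ)) : Set B.V :=
  B.componentSpan.mkQ '' {v | ∀ φ ∈ F, ∀ ψ ∈ P, v ⬝ᵥ ψ ≤ v ⬝ᵥ φ}

/-- The normal fan of `P ⊆ V*`: the normal cones of the nonempty faces of `P`. -/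
def normalFan (P : Set (S → ℝ)) : Set (Set B.V) :=
  {K | ∃ F, IsExposed ℝ P F ∧ F.Nonempty ∧ K = B.normalCone P F}

/-- `P` is a convex polytope in `V*` whose normal fan is the nested fan. -/
def RealizesNestedFan (P : Set (S → ℝ)) : Prop :=
  (∃ T : Finset (S → ℝ), P = convexHull ℝ (T : Set (S → ℝ))) ∧
  P ⊆ B.dualSpace ∧ B.normalFan P = B.nestedFan

/-- The explicit nested polytope `Π(B)`. -/
def nestedPolytope : Set (S → ℝ) :=
  {x | (∀ C ∈ B.components, ∑ i ∈ C, x i = 0) ∧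
    ∀ I ∈ B.sets, I ∉ B.components → ∀ C ∈ B.components, I ⊆ C →
      ∑ i ∈ I, x i ≤ (I.card : ℝ) * (2 ^ (C.card - 1) - 2 ^ (I.card - 1))}

end BuildingSet

/-- `F` is a two-dimensional face of `P` (`P` itself is allowed). -/
def IsTwoFace {S : Type*} [Fintype S] (P F : Set (S → ℝ)) : Prop :=
  IsExposed ℝ P F ∧ Module.finrank ℝ (vectorSpan ℝ F) = 2

/-- `F` is a (convex) `d`-gon: a two-dimensional set that is the convex hull of `d` points in convex
position. -/
def IsPolygon {S : Type*} [Fintype S] (d : ℕ) (F : Set (S → ℝ)) : Prop :=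
  Module.finrank ℝ (vectorSpan ℝ F) = 2 ∧
  ∃ v : Fin d → (S → ℝ), ConvexIndependent ℝ v ∧ F = convexHull ℝ (Set.range v)

/-!
Both descriptions of the nested polytope are used only through one property, `FacesMatchCells`: the
face of `P` on which a functional `h : S → ℝ` is maximal depends only on the family of *cells* of
`h`, where the cell of `i` is the greatest member of `B` that contains `i` and lies in the
superlevel set `{h ≥ h i}`, and inclusion of faces is reversed inclusion of these families. The
cells of `h` other than the components are the nested set whose cone has `h` in its relative
interior. For a polytope with normal fan `Δ(B)` the property follows because `h` lies in the cone of
its own cells (`exists_eq_sum_cells`, from the level sets of `h`) and, conversely, any nested set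
whose cone contains `h` contains these cells (`properCells_subset`). For the explicit polytope it
follows from the points at which exactly the inequalities of the cells of a given injective function
are equalities (`exists_vertex`).

The cells depend only on the weak order of `S` by the values of `h`, so `P` behaves like a
generalized permutohedron. The vertices of the face `F` of `h` are given by the injective functions
refining `h`, and each depends only on the order of that function on the classes of elements with a
common `h`-cell (`cell_subset_of_same_order`). For `i`, `j` in one class, `e_i - e_j` is parallel to
`F`, so if `F` has dimension two, all but at most two elements of `S` are representatives of the
classes. Hence the nontrivial classes are two pairs or one triple (a single pair gives only two
vertices), which yields at most `2! · 2!` or `3!` vertices.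

Two pairs always yield four vertices. For a triple `{a, b, c}` with cell `D` and a graphical `B`,
connectedness of `D` shows that at least two of the three pairs, say `ab` and `bc`, lie in a
connected subset of `D` that avoids the third element. Then the orders `abc`, `bac`, `bca`, `cba`
give four different families of cells, hence four different vertices, and `F` is not a triangle.
-/

namespace BuildingSet

/-! ### Weak orders and their refinements -/

section Refines

variable {S : Type*} {h h' : S → ℝ} {i j : S}

/-- `h'` refines `h` if the weak order of `S` by the values of `h'` is obtained from that of `h` by
breaking ties. -/
def Refines (h' h : S → ℝ) : Prop := ∀ i j, h i < h j → h' i < h' j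

theorem Refines.trans {a b c : S → ℝ} (hab : Refines a b) (hbc : Refines b c) : Refines a c :=
  fun i j hij => hab i j (hbc i j hij)

theorem Refines.le (H : Refines h' h) (hij : h' i ≤ h' j) : h i ≤ h j :=
  not_lt.1 fun hlt => (H j i hlt).not_ge hij

theorem Refines.symm_of_injective (H : Refines h' h) (hinj : Function.Injective h) :
    Refines h h' := fun i j hij =>
  lt_of_le_of_ne (H.le hij.le) fun he => hij.ne (by rw [hinj he])

theorem exists_injective_refines [Fintype S] (h : S → ℝ) :
    ∃ h' : S → ℝ, Function.Injective h' ∧ Refines h' h := by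
  classical
  let key : S → ℝ ×ₗ Fin (Fintype.card S) := fun i => toLex (h i, Fintype.equivFin S i)
  have hkey : Function.Injective key := fun i j hij =>
    (Fintype.equivFin S).injective (congrArg Prod.snd (toLex.injective hij))
  have hmono : ∀ i j, key i < key j →
      (Finset.univ.filter (key · < key i)).card < (Finset.univ.filter (key · < key j)).card :=
    fun i j hij => Finset.card_lt_card <| Finset.ssubset_iff_of_subset
      (fun k hk => by simp only [Finset.mem_filter_univ] at hk ⊢; exact hk.trans hij) |>.2
      ⟨i, by simpa using hij, by simp⟩
  refine ⟨fun i => ((Finset.univ.filter (key · < key i)).card : ℝ), fun i j hij => ?_,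
    fun i j hij => Nat.cast_lt.2 (hmono i j (Prod.Lex.toLex_lt_toLex.2 (Or.inl hij)))⟩
  rcases lt_trichotomy (key i) (key j) with hlt | heq | hlt
  · exact absurd (Nat.cast_injective hij) (hmono i j hlt).ne
  · exact hkey heq
  · exact absurd (Nat.cast_injective hij) (hmono j i hlt).ne'

/-- Small perturbations of `h` refine it. -/
theorem exists_pos_refines_add_smul [Fintype S] (h g : S → ℝ) :
    ∃ ε : ℝ, 0 < ε ∧ Refines (h + ε • g) h := by
  have hev : ∀ᶠ ε : ℝ in nhdsWithin 0 (Set.Ioi 0),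
      ∀ i j, h i < h j → h i + ε * g i < h j + ε * g j := by
    refine nhdsWithin_le_nhds (Filter.eventually_all.2 fun i => Filter.eventually_all.2 fun j => ?_)
    by_cases hij : h i < h j
    · have h1 : Filter.Tendsto (fun ε : ℝ => h i + ε * g i) (nhds 0) (nhds (h i)) :=
        Continuous.tendsto' (by fun_prop) _ _ (by simp)
      have h2 : Filter.Tendsto (fun ε : ℝ => h j + ε * g j) (nhds 0) (nhds (h j)) :=
        Continuous.tendsto' (by fun_prop) _ _ (by simp)
      filter_upwards [h1.eventually_lt h2 hij] with ε hε _ using hε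
    · exact Filter.Eventually.of_forall fun ε hlt => absurd hlt hij
  obtain ⟨ε, hε, hpos⟩ := (hev.and self_mem_nhdsWithin).exists
  exact ⟨ε, hpos, fun i j hij => by simpa using hε i j hij⟩

end Refines

/-! ### The cells of a function -/

section Cells

variable {S : Type*} [Fintype S] [DecidableEq S] (B : BuildingSet S)

/-- Among the members of `B` that contain `i` and lie in `U` there is a greatest one. -/
theorem exists_greatest_mem (U : Set S) {i : S} (hi : i ∈ U) :
    ∃ C ∈ B.sets, i ∈ C ∧ (∀ k ∈ C, k ∈ U) ∧
      ∀ K ∈ B.sets, i ∈ K → (∀ k ∈ K, k ∈ U) → K ⊆ C := by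
  have hfin : {K : Finset S | K ∈ B.sets ∧ i ∈ K ∧ ∀ k ∈ K, k ∈ U}.Finite := Set.toFinite _
  obtain ⟨C, hC⟩ := hfin.exists_maximal ⟨{i}, B.singleton_mem i, by simp, by simpa using hi⟩
  obtain ⟨hCB, hiC, hCU⟩ := hC.prop
  refine ⟨C, hCB, hiC, hCU, fun K hK hiK hKU => ?_⟩
  have hmem : C ∪ K ∈ {K : Finset S | K ∈ B.sets ∧ i ∈ K ∧ ∀ k ∈ K, k ∈ U} := by
    refine ⟨B.union_mem C hCB K hK ⟨i, by simp [hiC, hiK]⟩, by simp [hiC], fun k hk => ?_⟩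
    rcases Finset.mem_union.1 hk with hk | hk
    exacts [hCU k hk, hKU k hk]
  exact Finset.subset_union_right.trans (hC.le_of_ge hmem Finset.subset_union_left)

/-- The cell of `i` with respect to `h : S → ℝ` is the greatest member of `B` that contains `i` and
lies in the superlevel set `{h ≥ h i}`. The cells of `h` that are not components form the nested set
whose cone has `h` in its relative interior; keeping the components among the cells spares many case
distinctions. -/
noncomputable def cell (h : S → ℝ) (i : S) : Finset S :=
  (B.exists_greatest_mem {j | h i ≤ h j} (le_refl (h i))).choose

variable {B} {h g h' : S → ℝ} {i j k : S} {I K : Finset S}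

theorem cell_mem : B.cell h i ∈ B.sets :=
  (B.exists_greatest_mem {j | h i ≤ h j} (le_refl (h i))).choose_spec.1

theorem self_mem_cell : i ∈ B.cell h i :=
  (B.exists_greatest_mem {j | h i ≤ h j} (le_refl (h i))).choose_spec.2.1

theorem le_of_mem_cell (hj : j ∈ B.cell h i) : h i ≤ h j :=
  (B.exists_greatest_mem {j | h i ≤ h j} (le_refl (h i))).choose_spec.2.2.1 j hj

theorem subset_cell (hK : K ∈ B.sets) (hi : i ∈ K) (hle : ∀ k ∈ K, h i ≤ h k) : K ⊆ B.cell h i :=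
  (B.exists_greatest_mem {j | h i ≤ h j} (le_refl (h i))).choose_spec.2.2.2 K hK hi hle

theorem cell_subset_cell (hj : j ∈ B.cell h i) : B.cell h j ⊆ B.cell h i := by
  refine Finset.subset_union_right.trans (subset_cell
    (B.union_mem _ cell_mem _ (cell_mem (h := h) (i := j)) ⟨j, Finset.mem_inter.2
      ⟨hj, self_mem_cell⟩⟩) (Finset.mem_union_left _ (self_mem_cell (h := h))) fun k hk => ?_)
  rcases Finset.mem_union.1 hk with hk | hk
  exacts [le_of_mem_cell hk, (le_of_mem_cell hj).trans (le_of_mem_cell hk)]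

theorem cell_eq_cell (hj : j ∈ B.cell h i) (hle : h j ≤ h i) : B.cell h j = B.cell h i :=
  (cell_subset_cell hj).antisymm
    (subset_cell cell_mem hj fun _ hk => hle.trans (le_of_mem_cell hk))

theorem eq_of_cell_eq (hij : B.cell h i = B.cell h j) : h i = h j :=
  le_antisymm (le_of_mem_cell (B := B) (by rw [hij]; exact self_mem_cell))
    (le_of_mem_cell (B := B) (by rw [← hij]; exact self_mem_cell))

/-- The cells of a function form a laminar family. -/
theorem cell_subset_cell_of_le (hki : k ∈ B.cell h i) (hkj : k ∈ B.cell h j) (hij : h i ≤ h j) :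
    B.cell h j ⊆ B.cell h i := by
  refine Finset.subset_union_right.trans (subset_cell (B.union_mem _ cell_mem _ cell_mem
    ⟨k, Finset.mem_inter.2 ⟨hki, hkj⟩⟩) (Finset.mem_union_left _ self_mem_cell) fun l hl => ?_)
  rcases Finset.mem_union.1 hl with hl | hl
  exacts [le_of_mem_cell hl, hij.trans (le_of_mem_cell hl)]

/-- A cell containing `i` contains the cell of `i`. -/
theorem cell_subset_of_mem_range (hI : I ∈ Set.range (B.cell h)) (hi : i ∈ I) :
    B.cell h i ⊆ I := by
  obtain ⟨k, rfl⟩ := hI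
  exact cell_subset_cell hi

theorem exists_minimizer {S : Type*} [DecidableEq S] {B : BuildingSet S} {I : Finset S}
    (hI : I ∈ B.sets) (h : S → ℝ) : ∃ m ∈ I, ∀ k ∈ I, h m ≤ h k :=
  I.exists_min_image h (B.nonempty_of_mem I hI)

/-- Every component is a cell of every function. -/
theorem mem_range_cell_of_mem_components (hI : I ∈ B.components) (h : S → ℝ) :
    I ∈ Set.range (B.cell h) := by
  obtain ⟨m, hm, hle⟩ := exists_minimizer hI.prop h
  exact ⟨m, (hI.eq_of_le cell_mem (subset_cell hI.prop hm hle)).symm⟩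

/-- The cells of a constant function are the components. -/
theorem cell_zero_mem_components (i : S) : B.cell 0 i ∈ B.components :=
  ⟨cell_mem, fun _ hK hle => subset_cell hK (hle self_mem_cell) fun _ _ => le_rfl⟩

theorem subset_cell_zero (hK : K ∈ B.sets) (hi : i ∈ K) : K ⊆ B.cell 0 i :=
  subset_cell hK hi fun _ _ => le_rfl

theorem cell_zero_eq (hI : I ∈ B.components) (hi : i ∈ I) : B.cell 0 i = I :=
  (hI.eq_of_le cell_mem (subset_cell_zero hI.prop hi)).symm

theorem Refines.range_cell_subset (H : Refines h' h) :
    Set.range (B.cell h) ⊆ Set.range (B.cell h') := by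
  rintro _ ⟨i, rfl⟩
  obtain ⟨m, hm, hle⟩ := exists_minimizer (cell_mem (B := B) (h := h) (i := i)) h'
  refine ⟨m, Finset.Subset.antisymm ?_ (subset_cell cell_mem hm hle)⟩
  rw [← cell_eq_cell hm (H.le (hle i self_mem_cell))]
  exact subset_cell cell_mem self_mem_cell fun k hk => H.le (le_of_mem_cell hk)

/-- If all cells of `g` are cells of `h`, then `g` is constant on the set of elements with a given
`h`-cell. -/
theorem eq_of_range_cell_subset (H : Set.range (B.cell g) ⊆ Set.range (B.cell h))
    (hij : B.cell h i = B.cell h j) : g i = g j := by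
  have key : ∀ i j, B.cell h i = B.cell h j → g i ≤ g j := fun i j hij => by
    refine le_of_mem_cell (B := B) (i := i) ?_
    exact cell_subset_of_mem_range (H ⟨i, rfl⟩) self_mem_cell (hij ▸ self_mem_cell)
  exact (key i j hij).antisymm (key j i hij.symm)

theorem cell_eq_of_range_cell_eq (H : Set.range (B.cell g) = Set.range (B.cell h)) (i : S) :
    B.cell g i = B.cell h i :=
  (cell_subset_of_mem_range (H ▸ ⟨i, rfl⟩) self_mem_cell).antisymm
    (cell_subset_of_mem_range (H ▸ ⟨i, rfl⟩) self_mem_cell)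

/-- Adding to `h` a small multiple of `g` creates no new cells if `g` is constant on the set of
elements with a given `h`-cell. -/
theorem range_cell_add_smul_subset (H : ∀ i j, B.cell h i = B.cell h j → g i = g j) {ε : ℝ}
    (hε : Refines (h + ε • g) h) :
    Set.range (B.cell (h + ε • g)) ⊆ Set.range (B.cell h) := by
  rintro _ ⟨i, rfl⟩
  obtain ⟨l, hl, hle⟩ := exists_minimizer (cell_mem (B := B) (h := h + ε • g) (i := i)) h
  refine ⟨l, Finset.Subset.antisymm ?_ (subset_cell cell_mem hl hle)⟩
  refine (subset_cell cell_mem self_mem_cell fun j hj => ?_).trans (cell_subset_cell hl)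
  rcases (le_of_mem_cell hj).lt_or_eq with hlt | heq
  · exact (hε l j hlt).le
  · simp [heq, H j l (cell_eq_cell hj heq.ge)]

/-- The cells of a refinement `f` of `h` depend only on the order of `f` on the classes of elements
with a common `h`-cell. Only one inclusion is stated; the other one follows by symmetry. -/
theorem cell_subset_of_same_order {f f' : S → ℝ} (hf : Refines f h) (hf' : Refines f' h)
    (H : ∀ i j, B.cell h i = B.cell h j → f i ≤ f j → f' i ≤ f' j) (i : S) :
    B.cell f i ⊆ B.cell f' i := by
  refine subset_cell cell_mem self_mem_cell fun j hj => ?_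
  rcases (hf.le (le_of_mem_cell hj)).lt_or_eq with hlt | heq
  · exact (hf' i j hlt).le
  · have hsub : B.cell f i ⊆ B.cell h i :=
      subset_cell cell_mem self_mem_cell fun k hk => hf.le (le_of_mem_cell hk)
    exact H i j (cell_eq_cell (hsub hj) heq.ge).symm (le_of_mem_cell hj)

/-- The indicator function of the set where `h` attains its maximum is the sum of the indicator
functions of the cells contained in it. -/
theorem indicatorVec_top (t : ℝ) (ht : ∀ i, h i ≤ t) :
    indicatorVec (Finset.univ.filter (h · = t)) =
      ∑ I ∈ (Finset.univ.filter (h · = t)).image (B.cell h), indicatorVec I := by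
  funext j
  simp only [Finset.sum_apply, indicatorVec]
  by_cases hj : h j = t
  · rw [Finset.sum_eq_single_of_mem (B.cell h j) (Finset.mem_image_of_mem _ (by simpa using hj))]
    · simp [hj, self_mem_cell]
    · intro I hI hne
      obtain ⟨i, hi, rfl⟩ := Finset.mem_image.1 hI
      refine if_neg fun hmem => hne (cell_eq_cell hmem ?_).symm
      rw [hj, (Finset.mem_filter_univ _).1 hi]
  · rw [if_neg (by simpa using hj), Finset.sum_eq_zero]
    intro I hI
    obtain ⟨i, hi, rfl⟩ := Finset.mem_image.1 hI
    refine if_neg fun hmem => hj ((ht j).antisymm ?_)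
    rw [← (Finset.mem_filter_univ _).1 hi]
    exact le_of_mem_cell hmem

/-- Every function is a combination of the indicator functions of its cells, with coefficients that
are nonnegative off the components. -/
theorem exists_eq_sum_cells (B : BuildingSet S) (h : S → ℝ) : ∃ c : Finset S → ℝ,
    (∀ I, I ∉ B.components → 0 ≤ c I) ∧ (∀ I, c I ≠ 0 → I ∈ Set.range (B.cell h)) ∧
      h = ∑ I, c I • indicatorVec I := by
  classical
  -- Lowering the largest value of `h` to the second largest one subtracts a positive multiple of
  -- the indicator function of the top level, and the result is refined by `h`.
  induction hn : (Finset.univ.image h).card using Nat.strong_induction_on generalizing h with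
  | _ n ih =>
  rcases isEmpty_or_nonempty S with hS | hS
  · exact ⟨0, by simp, by simp, funext fun i => hS.elim i⟩
  obtain ⟨i₀, -, hi₀⟩ := Finset.univ.exists_max_image h Finset.univ_nonempty
  set t := h i₀ with ht
  have htop := indicatorVec_top (B := B) t fun i => hi₀ i (Finset.mem_univ i)
  set 𝒞 := (Finset.univ.filter (h · = t)).image (B.cell h) with h𝒞
  have h𝒞sub : ∀ I ∈ 𝒞, I ∈ Set.range (B.cell h) := fun I hI => by
    obtain ⟨i, -, rfl⟩ := Finset.mem_image.1 hI
    exact ⟨i, rfl⟩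
  have hsum : ∀ r : ℝ, ∑ I, (if I ∈ 𝒞 then r else 0) • indicatorVec I =
      r • indicatorVec (Finset.univ.filter (h · = t)) := fun r => by
    simp only [ite_smul, zero_smul, Finset.sum_ite_mem, Finset.univ_inter, htop, Finset.smul_sum]
  by_cases hconst : ∀ i, h i = t
  · refine ⟨fun I => if I ∈ 𝒞 then t else 0, fun I hI => ?_, fun I hI => ?_, ?_⟩
    · refine (if_neg fun hmem => ?_).ge
      obtain ⟨i, -, rfl⟩ := Finset.mem_image.1 hmem
      refine hI ⟨cell_mem, fun K hK hle => subset_cell hK (hle self_mem_cell) fun k _ => ?_⟩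
      rw [hconst, hconst]
    · by_contra hmem
      exact hI (if_neg fun hm => hmem (h𝒞sub I hm))
    · rw [hsum]
      funext i
      simp [indicatorVec, hconst]
  · push Not at hconst
    obtain ⟨i₁, hi₁⟩ := hconst
    obtain ⟨j₀, hj₀, hmax⟩ := (Finset.univ.filter (h · ≠ t)).exists_max_image h
      ⟨i₁, by simpa using hi₁⟩
    set s := h j₀ with hs
    have hst : s < t := lt_of_le_of_ne (hi₀ _ (Finset.mem_univ _)) (by simpa using hj₀)
    have hle : ∀ i, h i ≠ t → h i ≤ s := fun i hi => hmax i (by simpa using hi)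
    let h₁ : S → ℝ := fun i => min (h i) s
    have href : Refines h h₁ := fun i j hij =>
      not_le.1 fun hji => (min_le_min_right s hji).not_gt hij
    have hcard : (Finset.univ.image h₁).card < n := by
      rw [← hn]
      refine Finset.card_lt_card (Finset.ssubset_iff_of_subset (fun x hx => ?_) |>.2
        ⟨t, Finset.mem_image_of_mem h (Finset.mem_univ i₀), fun hx => ?_⟩)
      · obtain ⟨i, -, rfl⟩ := Finset.mem_image.1 hx
        rcases min_choice (h i) s with hm | hm <;> simp only [h₁, hm]
        · exact Finset.mem_image_of_mem h (Finset.mem_univ i)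
        · exact Finset.mem_image_of_mem h (Finset.mem_univ j₀)
      · obtain ⟨i, -, hi⟩ := Finset.mem_image.1 hx
        exact ((min_le_right (h i) s).trans_lt hst).ne hi
    obtain ⟨c, hc0, hcs, hc⟩ := ih _ hcard h₁ rfl
    refine ⟨fun I => c I + if I ∈ 𝒞 then t - s else 0, fun I hI => ?_, fun I hI => ?_, ?_⟩
    · have := hc0 I hI
      have hpos : 0 ≤ if I ∈ 𝒞 then t - s else 0 := by split_ifs <;> linarith
      exact add_nonneg this hpos
    · by_contra hmem
      refine hI ?_
      simp only [if_neg fun hm => hmem (h𝒞sub I hm), add_zero]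
      by_contra hne
      exact hmem (href.range_cell_subset (hcs I hne))
    · simp only [add_smul, Finset.sum_add_distrib, hsum, ← hc]
      funext i
      by_cases hi : h i = t
      · simp [indicatorVec, h₁, hi, hst.le]
      · simp [indicatorVec, h₁, hi, hle i hi]

end Cells

/-! ### Faces, and polytopes whose faces are governed by the cells -/

section Faces

/-- The face of `P` on which the functional `h` attains its maximum over `P`. -/
def maxFace {S : Type*} [Fintype S] (P : Set (S → ℝ)) (h : S → ℝ) : Set (S → ℝ) :=
  {x ∈ P | ∀ y ∈ P, h ⬝ᵥ y ≤ h ⬝ᵥ x}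

variable {S : Type*} [Fintype S] {P F : Set (S → ℝ)}

theorem isExposed_maxFace (h : S → ℝ) : IsExposed ℝ P (maxFace P h) := fun _ => by
  refine ⟨LinearMap.toContinuousLinearMap (dotProductBilin ℝ ℝ h), ?_⟩
  ext x
  simp [maxFace]

theorem exists_eq_dotProduct (l : StrongDual ℝ (S → ℝ)) : ∃ h : S → ℝ, ∀ x, l x = h ⬝ᵥ x := by
  classical
  refine ⟨fun i => l (Pi.single i 1), fun x => ?_⟩
  conv_lhs => rw [← Finset.univ_sum_single x]
  rw [map_sum]
  refine Finset.sum_congr rfl fun i _ => ?_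
  rw [show Pi.single i (x i) = x i • (Pi.single i (1 : ℝ) : S → ℝ) by
    rw [← Pi.single_smul, smul_eq_mul, mul_one], map_smul, smul_eq_mul, mul_comm]

theorem exists_eq_maxFace (hF : IsExposed ℝ P F) (hne : F.Nonempty) : ∃ h, F = maxFace P h := by
  obtain ⟨l, rfl⟩ := hF hne
  obtain ⟨h, hl⟩ := exists_eq_dotProduct l
  exact ⟨h, Set.ext fun x => and_congr_right fun _ => forall₂_congr fun y _ => by rw [hl x, hl y]⟩

variable [DecidableEq S] (B : BuildingSet S)

/-- The set `P` is convex, every functional attains its maximum over `P`, and one maximal face lies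
in another exactly if all cells of the second functional are cells of the first. This is what is
used of the two descriptions of the nested polytope. -/
structure FacesMatchCells (P : Set (S → ℝ)) : Prop where
  convex : Convex ℝ P
  nonempty : ∀ h, (maxFace P h).Nonempty
  subset_iff : ∀ h g, maxFace P h ⊆ maxFace P g ↔
    Set.range (B.cell g) ⊆ Set.range (B.cell h)

end Faces

/-! ### The nested fan -/

section Fan

variable {S : Type*} [Fintype S] [DecidableEq S] {B : BuildingSet S} {h g w : S → ℝ} {i j : S}
  {I J K : Finset S} {M : Finset (Finset S)}

theorem eq_of_mem_componentSpan (hw : w ∈ B.componentSpan) (hI : I ∈ B.components)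
    (hi : i ∈ I) (hj : j ∈ I) : w i = w j := by
  induction hw using Submodule.span_induction with
  | mem x hx =>
    obtain ⟨C, hC, rfl⟩ := hx
    have key : ∀ {i j}, i ∈ I → j ∈ I → i ∈ C → j ∈ C := fun hi hj hiC => by
      rwa [← cell_zero_eq hC hiC, cell_zero_eq hI hi]
    simp only [indicatorVec]
    simp only [show i ∈ C ↔ j ∈ C from ⟨key hi hj, key hj hi⟩]
  | zero => rfl
  | add x y _ _ hx hy => simp [hx, hy]
  | smul a x _ hx => simp [hx]

theorem indicatorVec_dotProduct (I : Finset S) (x : S → ℝ) :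
    indicatorVec I ⬝ᵥ x = ∑ i ∈ I, x i := by
  simp [indicatorVec, dotProduct, ite_mul]

theorem dotProduct_eq_zero_of_mem_componentSpan (hw : w ∈ B.componentSpan) {x : S → ℝ}
    (hx : x ∈ B.dualSpace) : w ⬝ᵥ x = 0 := by
  induction hw using Submodule.span_induction with
  | mem y hy =>
    obtain ⟨C, hC, rfl⟩ := hy
    rw [indicatorVec_dotProduct]
    exact hx C hC
  | zero => simp
  | add x y _ _ hx hy => simp [add_dotProduct, hx, hy]
  | smul a x _ hx => simp [smul_dotProduct, hx]

open Classical in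
/-- The cells of `h` that are not components. -/
noncomputable def properCells (B : BuildingSet S) (h : S → ℝ) : Finset (Finset S) :=
  Finset.univ.filter fun I => I ∈ Set.range (B.cell h) ∧ I ∉ B.components

theorem mem_properCells :
    I ∈ B.properCells h ↔ I ∈ Set.range (B.cell h) ∧ I ∉ B.components := by
  classical
  simp [properCells]

theorem isNested_properCells (B : BuildingSet S) (h : S → ℝ) : B.IsNested (B.properCells h) := by
  refine ⟨fun I hI => ?_, fun T hT hcard hanti hsup => ?_⟩
  · obtain ⟨⟨i, rfl⟩, hc⟩ := mem_properCells.1 hI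
    exact ⟨cell_mem, hc⟩
  · -- The member of `T` containing a minimizer of `h` on the union contains the whole union.
    obtain ⟨k, hk, hle⟩ := exists_minimizer hsup h
    obtain ⟨I, hI, hkI⟩ := Finset.mem_sup.1 hk
    have hsub : T.sup id ⊆ I := (subset_cell hsup hk hle).trans
      (cell_subset_of_mem_range (mem_properCells.1 (hT hI)).1 hkI)
    have hone : T ⊆ {I} := fun J hJ => Finset.mem_singleton.2 <| by
      by_contra hne
      exact hanti hJ hI hne ((Finset.le_sup (f := id) hJ).trans hsub)
    simpa using hcard.trans (Finset.card_le_card hone)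

theorem mkQ_mem_nestedCone_properCells (B : BuildingSet S) (h : S → ℝ) :
    B.componentSpan.mkQ h ∈ B.nestedCone (B.properCells h) := by
  obtain ⟨c, hc0, hcs, hc⟩ := B.exists_eq_sum_cells h
  refine ⟨c, fun I hI => hc0 I (mem_properCells.1 hI).2, ?_⟩
  conv_lhs => rw [hc]
  rw [map_sum]
  simp only [map_smul]
  refine (Finset.sum_subset (Finset.subset_univ _) fun I _ hI => ?_).symm
  by_cases hr : I ∈ Set.range (B.cell h)
  · have hcomp : I ∈ B.components := by
      by_contra hn
      exact hI (mem_properCells.2 ⟨hr, hn⟩)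
    have hmem : indicatorVec I ∈ B.componentSpan := Submodule.subset_span ⟨I, hcomp, rfl⟩
    rw [Submodule.mkQ_apply, (Submodule.Quotient.mk_eq_zero _).2 hmem, smul_zero]
  · rw [not_not.1 fun hne => hr (hcs I hne), zero_smul]

omit [Fintype S] in
theorem nestedCone_mono {N M : Finset (Finset S)} (hNM : N ⊆ M) :
    B.nestedCone N ⊆ B.nestedCone M := by
  rintro _ ⟨c, hc, rfl⟩
  refine ⟨fun I => if I ∈ N then c I else 0, fun I _ => ?_, ?_⟩
  · beta_reduce
    split_ifs with hI
    exacts [hc I hI, le_rfl]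
  · rw [← Finset.sum_subset hNM fun I _ hI => by simp [hI]]
    exact Finset.sum_congr rfl fun I hI => by simp [hI]

omit [Fintype S] in
theorem union_sup_mem (hK : K ∈ B.sets) {T : Finset (Finset S)}
    (hT : ∀ I ∈ T, I ∈ B.sets ∧ (K ∩ I).Nonempty) : K ∪ T.sup id ∈ B.sets := by
  induction T using Finset.induction_on with
  | empty => simpa using hK
  | insert I T _ ih =>
    have hI := hT I (Finset.mem_insert_self I T)
    have := B.union_mem _ (ih fun J hJ => hT J (Finset.mem_insert_of_mem hJ)) I hI.1
      (hI.2.mono (Finset.inter_subset_inter_right Finset.subset_union_left))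
    rwa [Finset.sup_insert, id, Finset.sup_eq_union, Finset.union_comm I, ← Finset.union_assoc]

omit [Fintype S] in
theorem IsNested.comparable (hM : B.IsNested M) (hI : I ∈ M) (hJ : J ∈ M)
    (hIJ : (I ∩ J).Nonempty) : I ⊆ J ∨ J ⊆ I := by
  by_contra! hno
  have hne : I ≠ J := fun he => hno.1 he.le
  refine hM.2 {I, J} ?_ (Finset.card_pair hne).ge ?_ ?_
  · simp [Finset.insert_subset_iff, hI, hJ]
  · intro X hX Y hY hXY
    simp only [Finset.coe_insert, Finset.coe_singleton, Set.mem_insert_iff,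
      Set.mem_singleton_iff] at hX hY
    rcases hX with rfl | rfl <;> rcases hY with rfl | rfl
    exacts [absurd rfl hXY, hno.1, hno.2, absurd rfl hXY]
  · simpa using B.union_mem I (hM.1 I hI).1 J (hM.1 J hJ).1 hIJ

omit [Fintype S] in
/-- A member `K` of `B` is not covered by those members of a nested set that do not contain `K`. -/
theorem IsNested.not_covered (hM : B.IsNested M) (hK : K ∈ B.sets)
    (hcov : ∀ i ∈ K, ∃ I ∈ M, i ∈ I ∧ ¬ K ⊆ I) : False := by
  classical
  set T₀ := M.filter fun I => (K ∩ I).Nonempty ∧ ¬ K ⊆ I with hT₀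
  set T := T₀.filter fun I => ∀ J ∈ T₀, I ⊆ J → J = I with hT
  have hTM : T ⊆ M := (Finset.filter_subset _ _).trans (Finset.filter_subset _ _)
  have hT' : ∀ I ∈ T, (K ∩ I).Nonempty ∧ ¬ K ⊆ I := fun I hI =>
    (Finset.mem_filter.1 (Finset.mem_filter.1 hI).1).2
  have hsup : K ⊆ T.sup id := fun i hi => by
    obtain ⟨I, hI, hiI, hKI⟩ := hcov i hi
    have hI₀ : I ∈ T₀ := Finset.mem_filter.2 ⟨hI, ⟨i, Finset.mem_inter.2 ⟨hi, hiI⟩⟩, hKI⟩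
    obtain ⟨J, hIJ, hJ⟩ := T₀.exists_le_maximal hI₀
    exact Finset.mem_sup.2 ⟨J, Finset.mem_filter.2
      ⟨hJ.prop, fun L hL hle => (hJ.eq_of_le hL hle).symm⟩, hIJ hiI⟩
  have hmem : T.sup id ∈ B.sets := by
    have := union_sup_mem hK (T := T) fun I hI => ⟨(hM.1 I (hTM hI)).1, (hT' I hI).1⟩
    rwa [Finset.union_eq_right.2 hsup] at this
  refine hM.2 T hTM ?_ ?_ hmem
  · by_contra! hlt
    rcases Finset.card_le_one_iff_subset_singleton.1 (Nat.lt_succ_iff.1 hlt) with ⟨J, hJ⟩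
    obtain ⟨i, hi⟩ := B.nonempty_of_mem K hK
    obtain ⟨I, hI, -⟩ := Finset.mem_sup.1 (hsup hi)
    obtain rfl := Finset.mem_singleton.1 (hJ hI)
    refine (hT' I hI).2 (hsup.trans (Finset.sup_le fun L hL => ?_))
    rw [Finset.mem_singleton.1 (hJ hL)]
    rfl
  · intro I hI J hJ hne hle
    exact hne ((Finset.mem_filter.1 hI).2 J (Finset.mem_filter.1 hJ).1 hle).symm

/-- If the class of `h` lies in the cone of a nested set `M`, then the cells of `h` that are not
components belong to `M`. -/
theorem properCells_subset (hM : B.IsNested M) (hh : B.componentSpan.mkQ h ∈ B.nestedCone M) :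
    B.properCells h ⊆ M := by
  classical
  obtain ⟨c, hc0, hc⟩ := hh
  obtain ⟨w, hw, hhw⟩ : ∃ w ∈ B.componentSpan, h = ∑ I ∈ M, c I • indicatorVec I + w := by
    refine ⟨h - ∑ I ∈ M, c I • indicatorVec I, ?_, by abel⟩
    rw [← Submodule.Quotient.mk_eq_zero, ← Submodule.mkQ_apply, map_sub, map_sum, hc]
    simp
  intro X hX
  obtain ⟨⟨i, rfl⟩, hXc⟩ := mem_properCells.1 hX
  set X := B.cell h i with hXdef
  by_contra hXM
  have hXB : X ∈ B.sets := cell_mem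
  -- It suffices that every `k ∈ X` lies in some `I ∈ M` that does not contain `X`.
  refine hM.not_covered hXB fun k hk => ?_
  by_contra! hno
  -- Otherwise every member of `M` containing `k` contains `X`. If there are such members, let `D`
  -- be the smallest of them, else the component of `k`. Then `h` is minimal at `k` on `D`, whence
  -- `D = X`, although `X` is neither a member of `M` nor a component.
  have hval : ∀ D ∈ B.sets, X ⊆ D → (∀ I ∈ M, k ∈ I → D ⊆ I) → D = X := by
    intro D hD hXD hDI
    refine Finset.Subset.antisymm (subset_cell hD (hXD self_mem_cell) fun j hj => ?_) hXD
    refine (le_of_mem_cell hk).trans ?_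
    have hwk : w k = w j := eq_of_mem_componentSpan hw (cell_zero_mem_components k) self_mem_cell
      (subset_cell_zero hD (hXD hk) hj)
    rw [hhw, Pi.add_apply, Pi.add_apply, hwk, Finset.sum_apply, Finset.sum_apply]
    refine add_le_add_left (Finset.sum_le_sum fun I hI => ?_) _
    by_cases hkI : k ∈ I
    · simp [indicatorVec, hkI, hDI I hI hkI hj]
    · simp only [indicatorVec, hkI, if_false, Pi.smul_apply, smul_eq_mul, mul_zero]
      exact mul_nonneg (hc0 I hI) (by split_ifs <;> norm_num)
  rcases (M.filter (k ∈ ·)).eq_empty_or_nonempty with hemp | hne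
  · refine hXc (hval _ (cell_mem (h := 0) (i := k)) (subset_cell_zero hXB hk)
      (fun I hI hkI => ?_) ▸ cell_zero_mem_components k)
    exact absurd (Finset.mem_filter.2 ⟨hI, hkI⟩) (hemp ▸ Finset.notMem_empty I)
  · obtain ⟨D, hD⟩ := Finset.exists_minimal hne
    obtain ⟨hDM, hkD⟩ := Finset.mem_filter.1 hD.prop
    refine hXM (hval D (hM.1 D hDM).1 (hno D hDM hkD) (fun I hI hkI => ?_) ▸ hDM)
    rcases hM.comparable hDM hI ⟨k, Finset.mem_inter.2 ⟨hkD, hkI⟩⟩ with hle | hle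
    · exact hle
    · exact hD.le_of_le (Finset.mem_filter.2 ⟨hI, hkI⟩) hle

theorem range_cell_subset_iff :
    Set.range (B.cell g) ⊆ Set.range (B.cell h) ↔ B.properCells g ⊆ B.properCells h := by
  refine ⟨fun H I hI => ?_, fun H I hI => ?_⟩
  · rw [mem_properCells] at hI ⊢
    exact ⟨H hI.1, hI.2⟩
  · by_cases hc : I ∈ B.components
    · exact mem_range_cell_of_mem_components hc h
    · exact (mem_properCells.1 (H (mem_properCells.2 ⟨hI, hc⟩))).1

theorem mkQ_mem_normalCone {P F : Set (S → ℝ)} (hP : P ⊆ B.dualSpace) (hF : F ⊆ P) :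
    B.componentSpan.mkQ h ∈ B.normalCone P F ↔ F ⊆ maxFace P h := by
  have hmax : F ⊆ maxFace P h ↔ ∀ φ ∈ F, ∀ ψ ∈ P, h ⬝ᵥ ψ ≤ h ⬝ᵥ φ :=
    ⟨fun H φ hφ => (H hφ).2, fun H φ hφ => ⟨hF hφ, H φ hφ⟩⟩
  rw [hmax]
  refine ⟨?_, fun H => ⟨h, H, rfl⟩⟩
  rintro ⟨v, hv, hvh⟩ φ hφ ψ hψ
  have hw : h - v ∈ B.componentSpan := by
    rw [← Submodule.Quotient.mk_eq_zero, ← Submodule.mkQ_apply, map_sub, hvh, sub_self]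
  have h1 := dotProduct_eq_zero_of_mem_componentSpan hw (hP hψ)
  have h2 := dotProduct_eq_zero_of_mem_componentSpan hw (hP (hF hφ))
  rw [sub_dotProduct, sub_eq_zero] at h1 h2
  rw [h1, h2]
  exact hv φ hφ ψ hψ

theorem RealizesNestedFan.facesMatchCells {P : Set (S → ℝ)} (hP : B.RealizesNestedFan P)
    (hne : P.Nonempty) : B.FacesMatchCells P := by
  obtain ⟨⟨T, hT⟩, hdual, hfan⟩ := hP
  have hcpt : IsCompact P := hT ▸ T.finite_toSet.isCompact_convexHull ℝ
  have hnonempty : ∀ h, (maxFace P h).Nonempty := fun h => by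
    obtain ⟨x, hx, hmax⟩ := hcpt.exists_isMaxOn hne
      (f := fun x => h ⬝ᵥ x) (by fun_prop)
    exact ⟨x, hx, fun y hy => hmax hy⟩
  have hsub : ∀ h, maxFace P h ⊆ P := fun h => Set.sep_subset _ _
  -- The normal cone of `maxFace P h` is the cone of some nested set `M` ...
  have hcone : ∀ h, ∃ M, B.IsNested M ∧ B.normalCone P (maxFace P h) = B.nestedCone M :=
    fun h => by
      have : B.normalCone P (maxFace P h) ∈ B.nestedFan :=
        hfan ▸ ⟨_, isExposed_maxFace h, hnonempty h, rfl⟩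
      exact this
  -- ... and it is contained in the cone of the cells of `h`.
  have hle : ∀ h, B.normalCone P (maxFace P h) ⊆ B.nestedCone (B.properCells h) := fun h => by
    obtain ⟨E, hE, hEne, hEcone⟩ : B.nestedCone (B.properCells h) ∈ B.normalFan P :=
      hfan ▸ ⟨_, B.isNested_properCells h, rfl⟩
    have hEh : E ⊆ maxFace P h := (mkQ_mem_normalCone hdual hE.subset).1
      (hEcone ▸ B.mkQ_mem_nestedCone_properCells h)
    rw [hEcone]
    rintro _ ⟨v, hv, rfl⟩
    exact ⟨v, fun φ hφ => hv φ (hEh hφ), rfl⟩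
  refine ⟨hT ▸ convex_convexHull ℝ _, hnonempty, fun h g => ?_⟩
  rw [range_cell_subset_iff, ← mkQ_mem_normalCone hdual (hsub h)]
  refine ⟨fun H => properCells_subset (B.isNested_properCells h) (hle h H), fun H => ?_⟩
  obtain ⟨M, hM, hMcone⟩ := hcone h
  have hhM : B.properCells h ⊆ M := properCells_subset hM
    (hMcone ▸ (mkQ_mem_normalCone hdual (hsub h)).2 subset_rfl)
  rw [hMcone]
  exact nestedCone_mono (H.trans hhM) (B.mkQ_mem_nestedCone_properCells g)

end Fan

/-! ### The explicit nested polytope -/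

section Explicit

/-- The right-hand side `n 2 ^ (n - 1)` of the inequality of a set of `n` elements in the shifted
coordinates. -/
noncomputable def sizeBound (n : ℕ) : ℝ := n * 2 ^ (n - 1)

theorem two_mul_sizeBound_lt (n : ℕ) : 2 * sizeBound n < sizeBound (n + 1) := by
  rcases n with _ | n
  · simp [sizeBound]
  · have : (0 : ℝ) < 2 ^ n := by positivity
    simp only [sizeBound, Nat.add_sub_cancel, pow_succ]
    push_cast
    nlinarith

theorem sizeBound_nonneg (n : ℕ) : 0 ≤ sizeBound n := by unfold sizeBound; positivity

theorem sizeBound_mono : Monotone sizeBound :=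
  monotone_nat_of_le_succ fun n => by
    linarith [two_mul_sizeBound_lt n, sizeBound_nonneg n]

theorem sizeBound_add_le (m n : ℕ) : sizeBound m + sizeBound n ≤ sizeBound (m + n) := by
  have hm : (2 : ℝ) ^ (m - 1) ≤ 2 ^ (m + n - 1) := pow_le_pow_right₀ one_le_two (by omega)
  have hn : (2 : ℝ) ^ (n - 1) ≤ 2 ^ (m + n - 1) := pow_le_pow_right₀ one_le_two (by omega)
  simp only [sizeBound, Nat.cast_add, add_mul]
  gcongr

variable {S : Type*} [Fintype S] [DecidableEq S] (B : BuildingSet S)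

/-- The change of coordinates `y j = 2 ^ (|C| - 1) - x j`, where `C` is the component of `j`. It is
an involution, and it turns the inequalities of the nested polytope into the inequalities
`∑ i ∈ I, y i ≥ |I| 2 ^ (|I| - 1)`, whose right-hand sides do not refer to the components. -/
noncomputable def shifted (x : S → ℝ) : S → ℝ := fun j => 2 ^ ((B.cell 0 j).card - 1) - x j

variable {B} {h g : S → ℝ} {i j : S} {I C : Finset S} {x y : S → ℝ}

theorem shifted_shifted (x : S → ℝ) : B.shifted (B.shifted x) = x := by
  funext j; simp [shifted]

theorem sum_shifted (hC : C ∈ B.components) (hIC : I ⊆ C) (x : S → ℝ) :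
    ∑ i ∈ I, B.shifted x i = I.card * 2 ^ (C.card - 1) - ∑ i ∈ I, x i := by
  simp only [shifted, Finset.sum_sub_distrib]
  rw [Finset.sum_congr rfl fun i hi => by rw [cell_zero_eq hC (hIC hi)], Finset.sum_const,
    nsmul_eq_mul]

theorem mem_nestedPolytope_iff : x ∈ B.nestedPolytope ↔
    (∀ C ∈ B.components, ∑ i ∈ C, B.shifted x i = sizeBound C.card) ∧
      ∀ I ∈ B.sets, sizeBound I.card ≤ ∑ i ∈ I, B.shifted x i := by
  constructor
  · rintro ⟨h1, h2⟩
    have h1' : ∀ C ∈ B.components, ∑ i ∈ C, B.shifted x i = sizeBound C.card := fun C hC => by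
      rw [sum_shifted hC subset_rfl, h1 C hC, sub_zero, sizeBound]
    refine ⟨h1', fun I hI => ?_⟩
    by_cases hc : I ∈ B.components
    · exact (h1' I hc).ge
    · obtain ⟨i, hi⟩ := B.nonempty_of_mem I hI
      have hsub : I ⊆ B.cell 0 i := subset_cell_zero hI hi
      have := h2 I hI hc _ (cell_zero_mem_components i) hsub
      rw [sum_shifted (cell_zero_mem_components i) hsub, sizeBound]
      linarith
  · rintro ⟨h1, h2⟩
    refine ⟨fun C hC => ?_, fun I hI _ C hC hIC => ?_⟩
    · have := h1 C hC
      rw [sum_shifted hC subset_rfl, sizeBound] at this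
      linarith
    · have := h2 I hI
      rw [sum_shifted hC hIC, sizeBound] at this
      linarith

/-- The sums over the cells of an injective function can be prescribed: by the order of the values
of `h`, the linear system is triangular. -/
theorem exists_cell_sums (B : BuildingSet S) (hinj : Function.Injective h) (b : S → ℝ) :
    ∃ y : S → ℝ, ∀ i, ∑ j ∈ B.cell h i, y j = b i := by
  let L : (S → ℝ) →ₗ[ℝ] (S → ℝ) :=
    { toFun := fun y i => ∑ j ∈ B.cell h i, y j
      map_add' := fun y z => by funext i; simp [Finset.sum_add_distrib]
      map_smul' := fun a y => by funext i; simp [Finset.mul_sum] }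
  have hL : Function.Injective L := by
    rw [injective_iff_map_eq_zero]
    intro y hy
    by_contra hne
    have hne' : (Finset.univ.filter (y · ≠ 0)).Nonempty := by
      obtain ⟨i, hi⟩ := Function.ne_iff.1 hne
      exact ⟨i, by simpa using hi⟩
    obtain ⟨i, hi, hmax⟩ := Finset.exists_max_image _ h hne'
    refine (Finset.mem_filter_univ _).1 hi ?_
    have hsum : ∑ j ∈ B.cell h i, y j = y i := by
      refine Finset.sum_eq_single_of_mem i self_mem_cell fun j hj hji => ?_
      by_contra hyj
      exact hji (hinj ((hmax j (by simpa using hyj)).antisymm (le_of_mem_cell hj)))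
    rw [← hsum]
    exact congrFun hy i
  obtain ⟨y, hy⟩ := LinearMap.injective_iff_surjective.1 hL b
  exact ⟨y, fun i => congrFun hy i⟩

/-- If the inequalities are equalities on the cells of `h`, then they are
reversed on the sets that are unions of cells. -/
theorem sum_le_sizeBound
    (hy : ∀ i, ∑ j ∈ B.cell h i, y j = sizeBound (B.cell h i).card) (U : Finset S)
    (hU : ∀ j ∈ U, B.cell h j ⊆ U) : ∑ j ∈ U, y j ≤ sizeBound U.card := by
  induction hn : U.card using Nat.strong_induction_on generalizing U with
  | _ n ih =>
  subst hn
  rcases U.eq_empty_or_nonempty with rfl | hne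
  · simp [sizeBound]
  obtain ⟨i, hi, hmin⟩ := U.exists_min_image h hne
  -- Split off the cell of a minimizer of `h`.
  have hsub := hU i hi
  have hcard : (U \ B.cell h i).card < U.card := Finset.card_lt_card
    (Finset.sdiff_ssubset hsub ⟨i, self_mem_cell⟩)
  have hrest := ih _ hcard (U \ B.cell h i) (fun j hj => ?_) rfl
  · rw [← Finset.sum_sdiff hsub, ← Finset.card_sdiff_add_card_eq_card hsub, hy i]
    exact (add_le_add_left hrest _).trans (sizeBound_add_le _ _)
  · rw [Finset.mem_sdiff] at hj
    refine Finset.subset_sdiff.2 ⟨hU j hj.1, Finset.disjoint_left.2 fun k hkj hki => hj.2 ?_⟩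
    exact cell_subset_cell_of_le hki hkj (hmin j hj.1) self_mem_cell

/-- For every injective `h`, some point of the nested polytope satisfies exactly the inequalities of
the cells of `h` with equality. -/
theorem exists_vertex (B : BuildingSet S) (hinj : Function.Injective h) :
    ∃ x ∈ B.nestedPolytope, ∀ I ∈ B.sets,
      ∑ i ∈ I, B.shifted x i = sizeBound I.card ↔ I ∈ Set.range (B.cell h) := by
  obtain ⟨y, hy⟩ := B.exists_cell_sums hinj fun i => sizeBound (B.cell h i).card
  have hlarge : ∀ i, sizeBound ((B.cell h i).card - 1) < y i := fun i => by
    have hrest := sum_le_sizeBound hy ((B.cell h i).erase i) fun j hj => by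
      obtain ⟨hji, hj⟩ := Finset.mem_erase.1 hj
      refine Finset.subset_erase.2 ⟨cell_subset_cell hj, fun hij => hji ?_⟩
      exact hinj ((le_of_mem_cell hij).antisymm (le_of_mem_cell hj))
    rw [Finset.card_erase_of_mem self_mem_cell] at hrest
    have hsum := Finset.add_sum_erase (B.cell h i) y self_mem_cell
    have hpos : 0 < (B.cell h i).card := Finset.card_pos.2 ⟨i, self_mem_cell⟩
    have htwo := two_mul_sizeBound_lt ((B.cell h i).card - 1)
    rw [Nat.sub_add_cancel hpos] at htwo
    have := hy i
    linarith
  have hstrict : ∀ I ∈ B.sets, I ∉ Set.range (B.cell h) → sizeBound I.card < ∑ i ∈ I, y i := by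
    intro I hI hr
    obtain ⟨i, hi, hmin⟩ := exists_minimizer hI h
    have hsub : I ⊂ B.cell h i := (subset_cell hI hi hmin).ssubset_of_ne fun he => hr ⟨i, he.symm⟩
    calc sizeBound I.card ≤ sizeBound ((B.cell h i).card - 1) :=
          sizeBound_mono (Nat.le_sub_one_of_lt (Finset.card_lt_card hsub))
      _ < y i := hlarge i
      _ ≤ ∑ i ∈ I, y i := Finset.single_le_sum
          (fun j _ => (sizeBound_nonneg _).trans (hlarge j).le) hi
  have htight : ∀ I ∈ Set.range (B.cell h), ∑ i ∈ I, y i = sizeBound I.card := by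
    rintro _ ⟨i, rfl⟩
    exact hy i
  refine ⟨B.shifted y, mem_nestedPolytope_iff.2 ?_, ?_⟩ <;> rw [shifted_shifted]
  · refine ⟨fun C hC => htight C (mem_range_cell_of_mem_components hC h), fun I hI => ?_⟩
    by_cases hr : I ∈ Set.range (B.cell h)
    exacts [(htight I hr).ge, (hstrict I hI hr).le]
  · exact fun I hI => ⟨fun he => by_contra fun hr => (hstrict I hI hr).ne' he, htight I⟩

theorem dotProduct_eq_sub_shifted (h x : S → ℝ) :
    h ⬝ᵥ x = h ⬝ᵥ B.shifted 0 - h ⬝ᵥ B.shifted x := by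
  rw [← dotProduct_sub]
  congr 1
  funext j
  simp [shifted]

/-- A point of the nested polytope that satisfies the inequalities of all cells of `h` with equality
maximizes `h`. -/
theorem mem_maxFace_nestedPolytope (hx : x ∈ B.nestedPolytope)
    (ht : ∀ I ∈ Set.range (B.cell h), ∑ i ∈ I, B.shifted x i = sizeBound I.card) :
    x ∈ maxFace B.nestedPolytope h := by
  refine ⟨hx, fun z hz => ?_⟩
  rw [dotProduct_eq_sub_shifted (B := B) h x, dotProduct_eq_sub_shifted (B := B) h z]
  refine sub_le_sub_left ?_ _
  obtain ⟨c, hc0, hcs, hc⟩ := B.exists_eq_sum_cells h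
  rw [hc]
  simp only [sum_dotProduct, smul_dotProduct, indicatorVec_dotProduct, smul_eq_mul]
  refine Finset.sum_le_sum fun I _ => ?_
  by_cases h0 : c I = 0
  · simp [h0]
  obtain ⟨i, rfl⟩ := hcs I h0
  rw [ht _ ⟨i, rfl⟩]
  rw [mem_nestedPolytope_iff] at hz
  by_cases hcomp : B.cell h i ∈ B.components
  · rw [hz.1 _ hcomp]
  · exact mul_le_mul_of_nonneg_left (hz.2 _ cell_mem) (hc0 _ hcomp)

/-- The cells of the indicator function of a member `I` of `B` are `I` and components. -/
theorem range_cell_indicatorVec_subset (hI : I ∈ Set.range (B.cell g)) :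
    Set.range (B.cell (indicatorVec I)) ⊆ Set.range (B.cell g) := by
  rintro _ ⟨i, rfl⟩
  by_cases hi : i ∈ I
  · convert hI
    refine Finset.Subset.antisymm (fun j hj => ?_) (subset_cell ?_ hi fun j hj => ?_)
    · have := le_of_mem_cell hj
      by_contra hjI
      simp only [indicatorVec, hi, hjI, if_true, if_false] at this
      linarith
    · obtain ⟨k, rfl⟩ := hI
      exact cell_mem
    · simp [indicatorVec, hi, hj]
  · refine mem_range_cell_of_mem_components ⟨cell_mem, fun K hK hle => ?_⟩ g
    refine subset_cell hK (hle self_mem_cell) fun k _ => ?_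
    simp only [indicatorVec, hi, if_false]
    split_ifs <;> norm_num

theorem maxFace_nestedPolytope_subset (H : Set.range (B.cell g) ⊆ Set.range (B.cell h)) :
    maxFace B.nestedPolytope h ⊆ maxFace B.nestedPolytope g := by
  intro x hx
  obtain ⟨h', hinj, href⟩ := exists_injective_refines h
  obtain ⟨x₀, hx₀, ht⟩ := B.exists_vertex hinj
  have hface : ∀ f, Set.range (B.cell f) ⊆ Set.range (B.cell h) →
      x₀ ∈ maxFace B.nestedPolytope f := fun f hf =>
    mem_maxFace_nestedPolytope hx₀ fun I hI => by
      have hI' := href.range_cell_subset (hf hI)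
      refine (ht I ?_).2 hI'
      obtain ⟨k, rfl⟩ := hI'
      exact cell_mem
  -- For small `ε > 0` both `g` and `h - ε g` are maximized at `x₀`; as `x` and `x₀` agree on `h`,
  -- `x` maximizes `g` as well.
  obtain ⟨ε, hε, hε'⟩ := exists_pos_refines_add_smul h (-g)
  have hx₀ε := hface _ (range_cell_add_smul_subset (g := -g)
    (fun i j hij => congrArg Neg.neg (eq_of_range_cell_subset H hij)) hε')
  have h1 := hx.2 x₀ hx₀
  have h2 := hx₀ε.2 x hx.1
  have h3 := (hface h subset_rfl).2 x hx.1
  simp only [add_dotProduct, smul_dotProduct, neg_dotProduct, smul_eq_mul] at h2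
  have hgx : g ⬝ᵥ x₀ ≤ g ⬝ᵥ x := by nlinarith
  exact ⟨hx.1, fun z hz => ((hface g H).2 z hz).trans hgx⟩

theorem tight_of_mem_maxFace (hx : x ∈ maxFace B.nestedPolytope g)
    (hI : I ∈ Set.range (B.cell g)) : ∑ i ∈ I, B.shifted x i = sizeBound I.card := by
  have hIB : I ∈ B.sets := by
    obtain ⟨k, rfl⟩ := hI
    exact cell_mem
  obtain ⟨g', hinj, href⟩ := exists_injective_refines g
  obtain ⟨x₀, hx₀, ht⟩ := B.exists_vertex hinj
  have hle := (maxFace_nestedPolytope_subset (range_cell_indicatorVec_subset hI) hx).2 x₀ hx₀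
  rw [dotProduct_eq_sub_shifted (B := B) _ x, dotProduct_eq_sub_shifted (B := B) _ x₀,
    indicatorVec_dotProduct, indicatorVec_dotProduct, indicatorVec_dotProduct,
    (ht I hIB).2 (href.range_cell_subset hI)] at hle
  have := (mem_nestedPolytope_iff.1 hx.1).2 I hIB
  linarith

/-- A member of `B` that is not a cell of `h` is not a cell of some injective refinement of `h`. -/
theorem exists_refines_notMem_range_cell (hI : I ∈ B.sets) (hIh : I ∉ Set.range (B.cell h)) :
    ∃ h', Function.Injective h' ∧ Refines h' h ∧ I ∉ Set.range (B.cell h') := by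
  -- As `I` is not a cell, it is a proper subset of the cell `K` of a minimizer of `h` on `I`.
  -- Ties are broken in favour of `K \ I`, so that `K` still lies in the superlevel set of `I`.
  obtain ⟨l, hl, hmin⟩ := exists_minimizer hI h
  set K := B.cell h l with hK
  obtain ⟨ε, hε, hε'⟩ := exists_pos_refines_add_smul h (indicatorVec (K \ I))
  obtain ⟨h', hinj, href⟩ := exists_injective_refines (h + ε • indicatorVec (K \ I))
  have href' := href.trans hε'
  refine ⟨h', hinj, href', ?_⟩
  rintro ⟨m, rfl⟩
  refine hIh ⟨l, (subset_cell hI hl hmin).antisymm' (subset_cell cell_mem ?_ fun j hj => ?_)⟩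
  · exact subset_cell hI hl hmin self_mem_cell
  · by_cases hjI : j ∈ B.cell h' m
    · exact le_of_mem_cell hjI
    · refine (href m j ?_).le
      have h1 : h m ≤ h l := href'.le (le_of_mem_cell hl)
      have h2 : h l ≤ h j := le_of_mem_cell hj
      have hj' : j ∈ K \ B.cell h' m := Finset.mem_sdiff.2 ⟨hj, hjI⟩
      have hm' : m ∉ K \ B.cell h' m := fun hm => (Finset.mem_sdiff.1 hm).2 self_mem_cell
      simp only [Pi.add_apply, Pi.smul_apply, indicatorVec, hj', hm', if_true, if_false,
        smul_eq_mul]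
      linarith

omit [Fintype S] in
theorem convex_nestedPolytope (B : BuildingSet S) : Convex ℝ B.nestedPolytope := by
  intro x hx y hy a b ha hb hab
  have hsum : ∀ I : Finset S,
      ∑ i ∈ I, (a • x + b • y) i = a * ∑ i ∈ I, x i + b * ∑ i ∈ I, y i := fun I => by
    simp [Finset.sum_add_distrib, Finset.mul_sum]
  refine ⟨fun C hC => ?_, fun I hI hc C hC hIC => ?_⟩
  · rw [hsum, hx.1 C hC, hy.1 C hC]
    ring
  · rw [hsum]
    exact convex_Iic (𝕜 := ℝ) _ (Set.mem_Iic.2 (hx.2 I hI hc C hC hIC))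
      (Set.mem_Iic.2 (hy.2 I hI hc C hC hIC)) ha hb hab

theorem facesMatchCells_nestedPolytope (B : BuildingSet S) :
    B.FacesMatchCells B.nestedPolytope := by
  have key : ∀ h h' : S → ℝ, Function.Injective h' → Refines h' h →
      ∃ x ∈ maxFace B.nestedPolytope h, ∀ I ∈ B.sets,
        ∑ i ∈ I, B.shifted x i = sizeBound I.card ↔ I ∈ Set.range (B.cell h') := by
    intro h h' hinj href
    obtain ⟨x, hx, ht⟩ := B.exists_vertex hinj
    refine ⟨x, mem_maxFace_nestedPolytope hx fun I hI => ?_, ht⟩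
    have hI' := href.range_cell_subset hI
    obtain ⟨k, rfl⟩ := hI
    exact (ht _ cell_mem).2 hI'
  refine ⟨convex_nestedPolytope B, fun h => ?_,
    fun h g => ⟨fun H => ?_, maxFace_nestedPolytope_subset⟩⟩
  · obtain ⟨h', hinj, href⟩ := exists_injective_refines h
    obtain ⟨x, hx, -⟩ := key h h' hinj href
    exact ⟨x, hx⟩
  · rintro _ ⟨i, rfl⟩
    by_contra hI
    obtain ⟨h', hinj, href, hI'⟩ := exists_refines_notMem_range_cell cell_mem hI
    obtain ⟨x, hx, ht⟩ := key h h' hinj href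
    exact hI' ((ht _ cell_mem).1 (tight_of_mem_maxFace (H hx) ⟨i, rfl⟩))

end Explicit

/-! ### The vertices of a face -/

theorem finite_range_and_ncard_le {X Y Z : Type*} (f : X → Z) (c : X → Y)
    (H : ∀ a b, c a = c b → f a = f b) (s : Finset Y) (hs : ∀ a, c a ∈ s) :
    (Set.range f).Finite ∧ (Set.range f).ncard ≤ s.card := by
  rcases isEmpty_or_nonempty X with hX | ⟨⟨x⟩⟩
  · simp [Set.range_eq_empty]
  have : Nonempty Z := ⟨f x⟩
  have hsub : Set.range f ⊆ Function.extend c f (fun _ => f x) '' s := by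
    rintro _ ⟨a, rfl⟩
    exact ⟨c a, hs a, Function.FactorsThrough.extend_apply (fun a b => H a b) _ a⟩
  have hfin := s.finite_toSet.image (Function.extend c f fun _ => f x)
  exact ⟨hfin.subset hsub, (Set.ncard_le_ncard hsub hfin).trans
    ((Set.ncard_image_le s.finite_toSet).trans (Set.ncard_coe_finset s).le)⟩

/-- The injective refinements of `h`. -/
def InjRefinement {S : Type*} (h : S → ℝ) : Type _ :=
  {f : S → ℝ // Function.Injective f ∧ Refines f h}

namespace FacesMatchCells

variable {S : Type*} [Fintype S] [DecidableEq S] {B : BuildingSet S} {P : Set (S → ℝ)}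
  {h f f' : S → ℝ} {x y : S → ℝ} (hP : B.FacesMatchCells P)

/-- A point of `P` at which `h` is maximal. It is the only one if `h` is injective. -/
noncomputable def vertex (h : S → ℝ) : S → ℝ := (hP.nonempty h).some

include hP

theorem vertex_mem (h : S → ℝ) : hP.vertex h ∈ maxFace P h := (hP.nonempty h).some_mem

theorem maxFace_subset_of_refines (hf : Refines f h) : maxFace P f ⊆ maxFace P h :=
  (hP.subset_iff f h).2 hf.range_cell_subset

theorem eq_vertex (hf : Function.Injective f) (hx : x ∈ maxFace P f) : x = hP.vertex f := by
  -- Every small perturbation of `f` has the same maximal face, so that all functionals agree on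
  -- the points of that face.
  have hv := hP.vertex_mem f
  have hdot : ∀ g : S → ℝ, g ⬝ᵥ x = g ⬝ᵥ hP.vertex f := fun g => by
    obtain ⟨ε, hε, href⟩ := exists_pos_refines_add_smul f g
    have hsub := hP.maxFace_subset_of_refines (href.symm_of_injective hf)
    have h1 := (hsub hx).2 _ hv.1
    have h2 := (hsub hv).2 _ hx.1
    have h3 := hx.2 _ hv.1
    have h4 := hv.2 _ hx.1
    simp only [add_dotProduct, smul_dotProduct, smul_eq_mul] at h1 h2
    have h5 : ε * (g ⬝ᵥ x) = ε * (g ⬝ᵥ hP.vertex f) := by linarith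
    exact mul_left_cancel₀ hε.ne' h5
  exact funext fun i => by simpa using hdot (Pi.single i 1)

theorem maxFace_eq_singleton (hf : Function.Injective f) : maxFace P f = {hP.vertex f} :=
  Set.Subset.antisymm (fun _ hx => hP.eq_vertex hf hx)
    (Set.singleton_subset_iff.2 (hP.vertex_mem f))

theorem vertex_eq_iff (hf : Function.Injective f) (hf' : Function.Injective f') :
    hP.vertex f = hP.vertex f' ↔ ∀ i, B.cell f i = B.cell f' i := by
  rw [← Set.singleton_eq_singleton_iff, ← hP.maxFace_eq_singleton hf,
    ← hP.maxFace_eq_singleton hf', Set.Subset.antisymm_iff, hP.subset_iff, hP.subset_iff]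
  refine ⟨fun H => cell_eq_of_range_cell_eq (H.2.antisymm H.1), fun H => ?_⟩
  rw [show B.cell f = B.cell f' from funext H]
  exact ⟨subset_rfl, subset_rfl⟩

/-- The vertex determined by an injective refinement of `h`. -/
noncomputable def vertexOf (u : InjRefinement h) : S → ℝ := hP.vertex u.1

theorem vertexOf_mem (u : InjRefinement h) : hP.vertexOf u ∈ maxFace P h :=
  hP.maxFace_subset_of_refines u.2.2 (hP.vertex_mem u.1)

theorem vertexOf_eq_of_same_order {u u' : InjRefinement h}
    (H : ∀ i j, B.cell h i = B.cell h j → i ≠ j → u.1 i < u.1 j → u'.1 i < u'.1 j) :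
    hP.vertexOf u = hP.vertexOf u' := by
  refine (hP.vertex_eq_iff u.2.1 u'.2.1).2 fun i => Finset.Subset.antisymm
    (cell_subset_of_same_order u.2.2 u'.2.2 (fun i j hij hle => ?_) i)
    (cell_subset_of_same_order u'.2.2 u.2.2 (fun i j hij hle => ?_) i)
  · rcases hle.lt_or_eq with hlt | heq
    · exact (H i j hij (fun he => hlt.ne (by rw [he])) hlt).le
    · rw [u.2.1 heq]
  · by_contra! hlt
    exact (H j i hij.symm (fun he => hlt.ne (by rw [he])) hlt).not_ge hle

theorem vertexOf_ne {u u' : InjRefinement h} {i j : S} (hj : j ∈ B.cell u.1 i)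
    (hlt : u'.1 j < u'.1 i) : hP.vertexOf u ≠ hP.vertexOf u' := fun he => by
  rw [(hP.vertex_eq_iff u.2.1 u'.2.1).1 he i] at hj
  exact (le_of_mem_cell hj).not_gt hlt

theorem finite_vertices (h : S → ℝ) :
    (Set.range fun u : InjRefinement h => hP.vertexOf u).Finite :=
  (finite_range_and_ncard_le _ (fun u : InjRefinement h => B.cell u.1)
    (fun u u' he => (hP.vertex_eq_iff u.2.1 u'.2.1).2 (congrFun he)) Finset.univ
    fun _ => Finset.mem_univ _).1

theorem convex_maxFace (h : S → ℝ) : Convex ℝ (maxFace P h) :=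
  (isExposed_maxFace h).convex hP.convex

theorem maxFace_eq_convexHull (h : S → ℝ) :
    maxFace P h = convexHull ℝ (Set.range fun u : InjRefinement h => hP.vertexOf u) := by
  refine Set.Subset.antisymm (fun z hz => ?_) (convexHull_min ?_ (hP.convex_maxFace h))
  · by_contra hz'
    obtain ⟨l, r, hl, hr⟩ := geometric_hahn_banach_closed_point (convex_convexHull ℝ _)
      ((hP.finite_vertices h).isClosed_convexHull ℝ) hz'
    obtain ⟨g, hg⟩ := exists_eq_dotProduct l
    -- The vertex of an injective refinement of `h + ε g` maximizes `g` on the face.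
    obtain ⟨ε, hε, href⟩ := exists_pos_refines_add_smul h g
    obtain ⟨f, hinj, hf⟩ := exists_injective_refines (h + ε • g)
    have hlt := hl _ (subset_convexHull ℝ _ ⟨⟨f, hinj, hf.trans href⟩, rfl⟩)
    have hmem := hP.vertex_mem f
    have h1 := (hP.maxFace_subset_of_refines hf hmem).2 z hz.1
    have h2 := hz.2 _ hmem.1
    simp only [vertexOf, hg] at hlt hr
    simp only [add_dotProduct, smul_dotProduct, smul_eq_mul] at h1
    nlinarith
  · rintro _ ⟨u, rfl⟩
    exact hP.vertexOf_mem u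

theorem convexIndependent_vertices (h : S → ℝ) :
    ConvexIndependent ℝ
      ((↑) : (Set.range fun u : InjRefinement h => hP.vertexOf u) → (S → ℝ)) := by
  rw [convexIndependent_set_iff_inter_convexHull_subset]
  rintro s hs _ ⟨⟨u, rfl⟩, hu⟩
  by_contra hmem
  -- The functional `u` is smaller at all other vertices.
  have hlt : ∀ y ∈ s, u.1 ⬝ᵥ y < u.1 ⬝ᵥ hP.vertexOf u := fun y hy => by
    have hyP : y ∈ P := by
      obtain ⟨u', rfl⟩ := hs hy
      exact (hP.vertexOf_mem u').1
    refine lt_of_le_of_ne ((hP.vertex_mem u.1).2 y hyP) fun he => hmem ?_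
    have : y ∈ maxFace P u.1 := ⟨hyP, fun z hz => he ▸ (hP.vertex_mem u.1).2 z hz⟩
    rw [hP.eq_vertex u.2.1 this] at hy
    exact hy
  have hconv : Convex ℝ {y | u.1 ⬝ᵥ y < u.1 ⬝ᵥ hP.vertexOf u} :=
    convex_halfSpace_lt (dotProductBilin ℝ ℝ u.1).isLinear _
  exact lt_irrefl (u.1 ⬝ᵥ hP.vertexOf u) (convexHull_min (fun y hy => hlt y hy) hconv hu)

/-- The number of vertices of the face of `h`. -/
noncomputable def vertexCount (h : S → ℝ) : ℕ :=
  (Set.range fun u : InjRefinement h => hP.vertexOf u).ncard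

theorem isPolygon_maxFace (hdim : Module.finrank ℝ (vectorSpan ℝ (maxFace P h)) = 2) :
    IsPolygon (hP.vertexCount h) (maxFace P h) ∧ 3 ≤ hP.vertexCount h := by
  set 𝒱 := Set.range fun u : InjRefinement h => hP.vertexOf u with h𝒱
  have hfin : 𝒱.Finite := hP.finite_vertices h
  have : Finite 𝒱 := hfin
  have e : 𝒱 ≃ Fin (hP.vertexCount h) := Finite.equivFin 𝒱
  have hrange : Set.range (fun k => ((e.symm k : 𝒱) : S → ℝ)) = 𝒱 := by
    rw [show (fun k => ((e.symm k : 𝒱) : S → ℝ)) = Subtype.val ∘ e.symm from rfl,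
      e.symm.surjective.range_comp, Subtype.range_coe]
  refine ⟨⟨hdim, fun k => e.symm k, ?_, ?_⟩, ?_⟩
  · exact (hP.convexIndependent_vertices h).comp_embedding e.symm.toEmbedding
  · rw [hrange]
    exact hP.maxFace_eq_convexHull h
  · have hspan : vectorSpan ℝ (maxFace P h) = vectorSpan ℝ 𝒱 := by
      rw [hP.maxFace_eq_convexHull h, ← direction_affineSpan, affineSpan_convexHull,
        direction_affineSpan]
    have hne : Nonempty (Fin (hP.vertexCount h)) := by
      obtain ⟨f, hinj, hf⟩ := exists_injective_refines h
      exact ⟨e ⟨_, ⟨f, hinj, hf⟩, rfl⟩⟩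
    have := finrank_vectorSpan_range_add_one_le ℝ (fun k => ((e.symm k : 𝒱) : S → ℝ))
    rw [hrange, ← hspan, hdim, Fintype.card_fin] at this
    exact this

/-- The vectors `e_i - e_j`, for `i` and `j` with the same `h`-cell, are parallel to the face of
`h`. -/
theorem single_sub_single_mem_vectorSpan {i j : S} (hij : B.cell h i = B.cell h j) :
    Pi.single i 1 - Pi.single j 1 ∈ vectorSpan ℝ (maxFace P h) := by
  by_contra hmem
  obtain ⟨l, hl, hker⟩ := Submodule.exists_le_ker_of_notMem hmem
  obtain ⟨g, hg⟩ := exists_eq_dotProduct (LinearMap.toContinuousLinearMap l)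
  have hg' : ∀ x, l x = g ⬝ᵥ x := hg
  -- As `g` is constant on the face of `h`, small perturbations of `h` in the direction of `g` are
  -- still maximal on that face; hence their cells are cells of `h`.
  obtain ⟨ε, hε, href⟩ := exists_pos_refines_add_smul h g
  obtain ⟨f, -, hf⟩ := exists_injective_refines (h + ε • g)
  have hv := hP.vertex_mem f
  have hvh := hP.maxFace_subset_of_refines (hf.trans href) hv
  have hsub : maxFace P h ⊆ maxFace P (h + ε • g) := fun x hx => by
    refine ⟨hx.1, fun z hz => ((hP.maxFace_subset_of_refines hf hv).2 z hz).trans (le_of_eq ?_)⟩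
    have h1 := LinearMap.mem_ker.1 (hker (vsub_mem_vectorSpan ℝ hvh hx))
    rw [vsub_eq_sub, map_sub, hg', hg', sub_eq_zero] at h1
    simp only [add_dotProduct, smul_dotProduct, h1, (hvh.2 x hx.1).antisymm (hx.2 _ hvh.1)]
  have hcells := (hP.subset_iff _ _).1 hsub
  have h2 := eq_of_range_cell_subset hcells hij
  rw [Pi.add_apply, Pi.add_apply, eq_of_cell_eq hij, add_right_inj, Pi.smul_apply, Pi.smul_apply,
    smul_eq_mul, smul_eq_mul, mul_right_inj' hε.ne'] at h2
  exact hl (by simp [hg', dotProduct_sub, h2])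

/-- If the face of `h` is a plane polygon, then all elements with at most two exceptions are
representatives of the classes of elements with the same `h`-cell. -/
theorem exists_representatives [Nonempty S]
    (hdim : Module.finrank ℝ (vectorSpan ℝ (maxFace P h)) = 2) :
    ∃ (r : S → S) (p q : S), (∀ i, B.cell h (r i) = B.cell h i) ∧
      (∀ i j, B.cell h i = B.cell h j → r i = r j) ∧ ∀ i, r i = i ∨ i = p ∨ i = q := by
  let r : S → S := fun i => Function.invFun (B.cell h) (B.cell h i)
  have hr : ∀ i, B.cell h (r i) = B.cell h i := fun i => Function.invFun_eq ⟨i, rfl⟩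
  have hr' : ∀ i j, B.cell h i = B.cell h j → r i = r j := fun i j hij => by simp only [r, hij]
  have hrr : ∀ i, r (r i) = r i := fun i => hr' _ _ (hr i)
  let X := Finset.univ.filter fun i => r i ≠ i
  let v : X → vectorSpan ℝ (maxFace P h) := fun i =>
    ⟨Pi.single (i : S) 1 - Pi.single (r i) 1,
      hP.single_sub_single_mem_vectorSpan (hr i).symm⟩
  -- These vectors are linearly independent, as only the one of `i` has a nonzero `i`-th coordinate.
  have hind : LinearIndependent ℝ v := by
    rw [Fintype.linearIndependent_iff]
    intro c hc i
    have h1 : ∑ j, c j * ((v j : S → ℝ) i) = 0 := by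
      have := congrFun (congrArg Subtype.val hc) (i : S)
      simpa using this
    rw [Finset.sum_eq_single i] at h1
    · have hi : (i : S) ≠ r i := fun he => (Finset.mem_filter_univ _).1 i.2 he.symm
      simpa [v, Pi.single_apply, hi] using h1
    · intro j _ hji
      have h2 : (i : S) ≠ j := fun he => hji (Subtype.ext he.symm)
      have h3 : (i : S) ≠ r j := fun he => (Finset.mem_filter_univ _).1 i.2 (by rw [he, hrr])
      simp [v, h2, h3]
    · simp
  have hcard : X.card ≤ 2 := by
    have := hind.fintype_card_le_finrank
    rwa [hdim, Fintype.card_coe] at this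
  obtain ⟨p, q, hpq⟩ : ∃ p q : S, X ⊆ {p, q} := by
    have hcases : X.card = 0 ∨ X.card = 1 ∨ X.card = 2 := by omega
    rcases hcases with h0 | h1 | h2
    · obtain ⟨p⟩ := ‹Nonempty S›
      exact ⟨p, p, by simp [Finset.card_eq_zero.1 h0]⟩
    · obtain ⟨p, hp⟩ := Finset.card_eq_one.1 h1
      exact ⟨p, p, by simp [hp]⟩
    · obtain ⟨p, q, -, hpq⟩ := Finset.card_eq_two.1 h2
      exact ⟨p, q, hpq.le⟩
  refine ⟨r, p, q, hr, hr', fun i => ?_⟩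
  by_cases hi : r i = i
  · exact Or.inl hi
  · exact Or.inr (by simpa using hpq (by simpa [X] using hi : i ∈ X))

/-- The classes of elements with the same `h`-cell, if the face of `h` is a plane polygon: apart
from singletons there is at most one class with two elements, or there are two classes with two
elements, or there is one with three. The first alternative is excluded later, as it leaves room for
two vertices only. -/
theorem classes_of_finrank_eq_two [Nonempty S]
    (hdim : Module.finrank ℝ (vectorSpan ℝ (maxFace P h)) = 2) :
    (∃ a b, ∀ i j, B.cell h i = B.cell h j → i ≠ j → (i = a ∧ j = b) ∨ (i = b ∧ j = a)) ∨
    (∃ a b c d, a ≠ b ∧ c ≠ d ∧ B.cell h a = B.cell h b ∧ B.cell h c = B.cell h d ∧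
      B.cell h a ≠ B.cell h c ∧ ∀ i j, B.cell h i = B.cell h j → i ≠ j →
        (i = a ∧ j = b) ∨ (i = b ∧ j = a) ∨ (i = c ∧ j = d) ∨ (i = d ∧ j = c)) ∨
    (∃ a b c, a ≠ b ∧ b ≠ c ∧ a ≠ c ∧ B.cell h a = B.cell h b ∧ B.cell h b = B.cell h c ∧
      ∀ i j, B.cell h i = B.cell h j → i ≠ j →
        (i = a ∨ i = b ∨ i = c) ∧ (j = a ∨ j = b ∨ j = c)) := by
  obtain ⟨r, p, q, hr, hr', hpq⟩ := hP.exists_representatives hdim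
  have hp := hr p
  have hq := hr q
  by_cases hpr : r p = p
  · exact Or.inl ⟨q, r q, by grind⟩
  by_cases hqr : r q = q
  · exact Or.inl ⟨p, r p, by grind⟩
  by_cases hpq' : p = q
  · exact Or.inl ⟨p, r p, by grind⟩
  by_cases hcell : B.cell h p = B.cell h q
  · exact Or.inr (Or.inr ⟨p, q, r p, by grind⟩)
  · exact Or.inr (Or.inl ⟨p, r p, q, r q, by grind⟩)

end FacesMatchCells

/-! ### Linked pairs in graphical building sets -/

section Linked

variable {S : Type*} [DecidableEq S] {B : BuildingSet S} {D : Finset S} {a b c : S}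

/-- The elements `a` and `b` lie in a member of `B` that is contained in `D` and avoids `c`. -/
def Linked (B : BuildingSet S) (D : Finset S) (a b c : S) : Prop :=
  ∃ K ∈ B.sets, K ⊆ D ∧ a ∈ K ∧ b ∈ K ∧ c ∉ K

theorem Linked.symm (H : B.Linked D a b c) : B.Linked D b a c := by
  obtain ⟨K, hK, hKD, ha, hb, hc⟩ := H
  exact ⟨K, hK, hKD, hb, ha, hc⟩

/-- In a connected set `D`, a walk from `a` to `b` first meets `{b, c}` either in `b` or in `c`. The
proof replaces the initial part of the walk by the largest connected set around `a` that avoids `b`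
and `c`, and adds the first vertex outside. -/
theorem linked_or_linked_of_graph [Fintype S] (Γ : SimpleGraph S)
    (hD : D ∈ (graphicalBuilding Γ).sets) (ha : a ∈ D) (hb : b ∈ D) (hab : a ≠ b) (hac : a ≠ c)
    (hbc : b ≠ c) :
    (graphicalBuilding Γ).Linked D a b c ∨ (graphicalBuilding Γ).Linked D a c b := by
  obtain ⟨K, hK, haK, hKU, hmax⟩ := (graphicalBuilding Γ).exists_greatest_mem
    {j | j ∈ D ∧ j ≠ b ∧ j ≠ c} (i := a) ⟨ha, hab, hac⟩
  have hconn : (Γ.induce (D : Set S)).Connected := hD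
  obtain ⟨w⟩ := hconn.preconnected ⟨a, ha⟩ ⟨b, hb⟩
  obtain ⟨d, -, hx, hy⟩ := w.exists_boundary_dart {x | x.1 ∈ K} haK fun hbK => (hKU b hbK).2.1 rfl
  obtain ⟨⟨⟨x, hxD⟩, ⟨y, hyD⟩⟩, hadj⟩ := d
  replace hx : x ∈ K := hx
  replace hy : y ∉ K := hy
  replace hyD : y ∈ D := hyD
  have hxy : ({x, y} : Finset S) ∈ (graphicalBuilding Γ).sets := by
    have : (Γ.induce ({x, y} : Set S)).Connected :=
      SimpleGraph.induce_pair_connected_of_adj hadj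
    rw [← Finset.coe_pair] at this
    exact this
  have hL := (graphicalBuilding Γ).union_mem K hK {x, y} hxy ⟨x, by simp [hx]⟩
  have hLD : K ∪ {x, y} ⊆ D := fun k hk => by
    rcases Finset.mem_union.1 hk with hk | hk
    · exact (hKU k hk).1
    · rcases Finset.mem_insert.1 hk with rfl | hk
      exacts [hxD, Finset.mem_singleton.1 hk ▸ hyD]
  have hbK : b ∉ K := fun h => (hKU b h).2.1 rfl
  have hcK : c ∉ K := fun h => (hKU c h).2.2 rfl
  have hor : y = b ∨ y = c := by
    by_contra! hne
    refine hy (hmax _ hL (by simp [haK]) (fun k hk => ?_) (by simp : y ∈ K ∪ {x, y}))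
    refine ⟨hLD hk, ?_⟩
    grind
  rcases hor with rfl | rfl
  · exact Or.inl ⟨_, hL, hLD, by simp [haK], by simp, by grind⟩
  · exact Or.inr ⟨_, hL, hLD, by simp [haK], by simp, by grind⟩

end Linked

/-! ### The number of vertices of a two-dimensional face -/

namespace FacesMatchCells

variable {S : Type*} [Fintype S] [DecidableEq S] {B : BuildingSet S} {P : Set (S → ℝ)}
  {h : S → ℝ} {a b c d : S}

omit [Fintype S] [DecidableEq S] in
theorem lt_of_decide_eq {f f' : S → ℝ} (hf' : Function.Injective f') {i j a b : S} (hij : i ≠ j)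
    (hpair : (i = a ∧ j = b) ∨ (i = b ∧ j = a))
    (he : decide (f a < f b) = decide (f' a < f' b)) (hlt : f i < f j) : f' i < f' j := by
  rw [decide_eq_decide] at he
  rcases hpair with ⟨rfl, rfl⟩ | ⟨rfl, rfl⟩
  · exact he.1 hlt
  · exact (not_lt.1 fun hlt' => (he.2 hlt').not_gt hlt).lt_of_ne (hf'.ne hij)

omit [DecidableEq S] in
/-- Injective refinements of `h` exist with any prescribed order on the classes of `h`. -/
theorem exists_injRefinement (h g : S → ℝ) :
    ∃ u : InjRefinement h, ∀ i j, h i = h j → g i < g j → u.1 i < u.1 j := by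
  obtain ⟨ε, hε, href⟩ := exists_pos_refines_add_smul h g
  obtain ⟨f, hinj, hf⟩ := exists_injective_refines (h + ε • g)
  refine ⟨⟨f, hinj, hf.trans href⟩, fun i j hij hlt => hf i j ?_⟩
  simp only [Pi.add_apply, Pi.smul_apply, smul_eq_mul, hij]
  have := mul_lt_mul_of_pos_left hlt hε
  linarith

/-- A member of `B` in the `h`-cell of `i` lies in the `u`-cell of `i`, for a refinement `u` of `h`,
as soon as `u` is minimal at `i` on those of its elements that have the same `h`-cell as `i`. -/
theorem subset_cell_of_le (u : InjRefinement h) {i : S} {K : Finset S} (hK : K ∈ B.sets)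
    (hi : i ∈ K) (hKi : K ⊆ B.cell h i)
    (hle : ∀ j ∈ K, B.cell h j = B.cell h i → u.1 i ≤ u.1 j) : K ⊆ B.cell u.1 i :=
  subset_cell hK hi fun j hj => (le_of_mem_cell (hKi hj)).lt_or_eq.elim
    (fun hlt => (u.2.2 i j hlt).le) fun heq => hle j hj (cell_eq_cell (hKi hj) heq.ge)

variable (hP : B.FacesMatchCells P)

include hP

theorem vertexCount_le_of_code {Y : Type*} (code : InjRefinement h → Y) (s : Finset Y)
    (hs : ∀ u, code u ∈ s)
    (H : ∀ u u', code u = code u' → ∀ i j, B.cell h i = B.cell h j → i ≠ j →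
      u.1 i < u.1 j → u'.1 i < u'.1 j) : hP.vertexCount h ≤ s.card :=
  (finite_range_and_ncard_le _ code
    (fun u u' he => hP.vertexOf_eq_of_same_order (H u u' he)) s hs).2

theorem four_le_vertexCount {u₁ u₂ u₃ u₄ : InjRefinement h}
    (h12 : hP.vertexOf u₁ ≠ hP.vertexOf u₂) (h13 : hP.vertexOf u₁ ≠ hP.vertexOf u₃)
    (h14 : hP.vertexOf u₁ ≠ hP.vertexOf u₄) (h23 : hP.vertexOf u₂ ≠ hP.vertexOf u₃)
    (h24 : hP.vertexOf u₂ ≠ hP.vertexOf u₄) (h34 : hP.vertexOf u₃ ≠ hP.vertexOf u₄) :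
    4 ≤ hP.vertexCount h := by
  classical
  let s : Finset (S → ℝ) := {hP.vertexOf u₁, hP.vertexOf u₂, hP.vertexOf u₃, hP.vertexOf u₄}
  have hs : s.card = 4 := by
    simp [s, Finset.card_insert_of_notMem, h12, h13, h14, h23, h24, h34]
  rw [← hs, ← Set.ncard_coe_finset, vertexCount]
  refine Set.ncard_le_ncard (fun x hx => ?_) (hP.finite_vertices h)
  simp only [s, Finset.coe_insert, Finset.coe_singleton, Set.mem_insert_iff,
    Set.mem_singleton_iff] at hx
  rcases hx with rfl | rfl | rfl | rfl
  exacts [⟨_, rfl⟩, ⟨_, rfl⟩, ⟨_, rfl⟩, ⟨_, rfl⟩]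

theorem vertexCount_le_two
    (H : ∀ i j, B.cell h i = B.cell h j → i ≠ j → (i = a ∧ j = b) ∨ (i = b ∧ j = a)) :
    hP.vertexCount h ≤ 2 :=
  hP.vertexCount_le_of_code (fun u => decide (u.1 a < u.1 b)) Finset.univ
    (fun _ => Finset.mem_univ _) fun _ u' he i j hij hne hlt =>
      lt_of_decide_eq u'.2.1 hne (H i j hij hne) he hlt

theorem vertexCount_le_four
    (H : ∀ i j, B.cell h i = B.cell h j → i ≠ j →
      (i = a ∧ j = b) ∨ (i = b ∧ j = a) ∨ (i = c ∧ j = d) ∨ (i = d ∧ j = c)) :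
    hP.vertexCount h ≤ 4 := by
  refine hP.vertexCount_le_of_code (fun u => (decide (u.1 a < u.1 b), decide (u.1 c < u.1 d)))
    Finset.univ (fun _ => Finset.mem_univ _) fun u u' he i j hij hne hlt => ?_
  obtain ⟨h1, h2⟩ := Prod.ext_iff.1 he
  rcases H i j hij hne with H | H | H | H
  · exact lt_of_decide_eq u'.2.1 hne (Or.inl H) h1 hlt
  · exact lt_of_decide_eq u'.2.1 hne (Or.inr H) h1 hlt
  · exact lt_of_decide_eq u'.2.1 hne (Or.inl H) h2 hlt
  · exact lt_of_decide_eq u'.2.1 hne (Or.inr H) h2 hlt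

theorem vertexCount_le_six
    (H : ∀ i j, B.cell h i = B.cell h j → i ≠ j →
      (i = a ∨ i = b ∨ i = c) ∧ (j = a ∨ j = b ∨ j = c)) :
    hP.vertexCount h ≤ 6 := by
  -- Of the eight sign patterns, the two cyclic ones do not come from an order.
  refine hP.vertexCount_le_of_code
    (fun u => (decide (u.1 a < u.1 b), decide (u.1 b < u.1 c), decide (u.1 a < u.1 c)))
    (Finset.univ.filter fun t => t ≠ (true, true, false) ∧ t ≠ (false, false, true))
    (fun u => ?_) fun u u' he i j hij hne hlt => ?_
  · simp only [Finset.mem_filter_univ, ne_eq, Prod.mk.injEq, decide_eq_true_eq,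
      decide_eq_false_iff_not, not_and, not_lt]
    exact ⟨fun h1 h2 => (h1.trans h2).not_ge, fun h1 h2 => h2.trans h1⟩
  · simp only [Prod.mk.injEq] at he
    obtain ⟨h1, h2, h3⟩ := he
    obtain ⟨rfl | rfl | rfl, rfl | rfl | rfl⟩ := H i j hij hne
    · exact absurd rfl hne
    · exact lt_of_decide_eq u'.2.1 hne (Or.inl ⟨rfl, rfl⟩) h1 hlt
    · exact lt_of_decide_eq u'.2.1 hne (Or.inl ⟨rfl, rfl⟩) h3 hlt
    · exact lt_of_decide_eq u'.2.1 hne (Or.inr ⟨rfl, rfl⟩) h1 hlt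
    · exact absurd rfl hne
    · exact lt_of_decide_eq u'.2.1 hne (Or.inl ⟨rfl, rfl⟩) h2 hlt
    · exact lt_of_decide_eq u'.2.1 hne (Or.inr ⟨rfl, rfl⟩) h3 hlt
    · exact lt_of_decide_eq u'.2.1 hne (Or.inr ⟨rfl, rfl⟩) h2 hlt
    · exact absurd rfl hne

/-- If `{a, b}` is a class of `h`, then refinements of `h` that order `a` and `b` differently belong
to different vertices. -/
theorem vertexOf_ne_of_pair (hab : B.cell h a = B.cell h b)
    (H : ∀ i, B.cell h i = B.cell h a → i = a ∨ i = b) {u u' : InjRefinement h}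
    (hu : u.1 a < u.1 b) (hu' : u'.1 b < u'.1 a) : hP.vertexOf u ≠ hP.vertexOf u' := by
  refine hP.vertexOf_ne (i := a) (j := b) ?_ hu'
  refine subset_cell_of_le u cell_mem self_mem_cell subset_rfl (fun j _ hj => ?_)
    (hab ▸ self_mem_cell)
  rcases H j hj with rfl | rfl
  exacts [le_rfl, hu.le]

/-- Two classes with two elements give a quadrilateral. -/
theorem four_le_of_two_pairs (hab : a ≠ b) (hcd : c ≠ d) (hab' : B.cell h a = B.cell h b)
    (hcd' : B.cell h c = B.cell h d) (hac : B.cell h a ≠ B.cell h c)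
    (H : ∀ i j, B.cell h i = B.cell h j → i ≠ j →
      (i = a ∧ j = b) ∨ (i = b ∧ j = a) ∨ (i = c ∧ j = d) ∨ (i = d ∧ j = c)) :
    4 ≤ hP.vertexCount h := by
  have hA : ∀ i, B.cell h i = B.cell h a → i = a ∨ i = b := by grind
  have hC : ∀ i, B.cell h i = B.cell h c → i = c ∨ i = d := by grind
  have had : B.cell h a ≠ B.cell h d := hcd' ▸ hac
  have hac₀ : a ≠ c := fun he => hac (by rw [he])
  have had₀ : a ≠ d := fun he => had (by rw [he])
  have hcb₀ : c ≠ b := fun he => hac (by rw [he, hab'])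
  have key : ∀ s t : ℝ, ∃ u : InjRefinement h,
      (s < 0 → u.1 a < u.1 b) ∧ (0 < s → u.1 b < u.1 a) ∧
        (t < 0 → u.1 c < u.1 d) ∧ (0 < t → u.1 d < u.1 c) := fun s t => by
    obtain ⟨u, hu⟩ := exists_injRefinement h (Pi.single a s + Pi.single c t)
    have h1 := eq_of_cell_eq hab'
    have h2 := eq_of_cell_eq hcd'
    refine ⟨u, fun hs => hu a b h1 ?_, fun hs => hu b a h1.symm ?_, fun ht => hu c d h2 ?_,
      fun ht => hu d c h2.symm ?_⟩ <;>
    simpa [Pi.single_apply, hab, hab.symm, hcd.symm, hac₀, hac₀.symm, had₀.symm, hcb₀.symm]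
  obtain ⟨u₁, h1, -, h1', -⟩ := key (-1) (-1)
  obtain ⟨u₂, h2, -, -, h2'⟩ := key (-1) 1
  obtain ⟨u₃, -, h3, h3', -⟩ := key 1 (-1)
  obtain ⟨u₄, -, h4, -, h4'⟩ := key 1 1
  norm_num at h1 h1' h2 h2' h3 h3' h4 h4'
  exact hP.four_le_vertexCount (hP.vertexOf_ne_of_pair hcd' hC h1' h2')
    (hP.vertexOf_ne_of_pair hab' hA h1 h3) (hP.vertexOf_ne_of_pair hab' hA h1 h4)
    (hP.vertexOf_ne_of_pair hab' hA h2 h3) (hP.vertexOf_ne_of_pair hab' hA h2 h4)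
    (hP.vertexOf_ne_of_pair hcd' hC h3' h4')

/-- A class `{a, b, c}` in which both `a, b` and `b, c` are linked gives at least four vertices. -/
theorem four_le_of_linked (hab : a ≠ b) (hbc : b ≠ c) (hac : a ≠ c)
    (hab' : B.cell h a = B.cell h b) (hbc' : B.cell h b = B.cell h c)
    (H : ∀ i, B.cell h i = B.cell h b → i = a ∨ i = b ∨ i = c)
    (hL : B.Linked (B.cell h b) a b c) (hL' : B.Linked (B.cell h b) b c a) :
    4 ≤ hP.vertexCount h := by
  obtain ⟨K, hK, hKD, haK, hbK, hcK⟩ := hL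
  obtain ⟨K', hK', hKD', hbK', hcK', haK'⟩ := hL'
  have key : ∀ s t : ℝ, ∃ u : InjRefinement h,
      (s < t → u.1 a < u.1 b) ∧ (t < s → u.1 b < u.1 a) ∧ (t < 0 → u.1 b < u.1 c) ∧
        (0 < t → u.1 c < u.1 b) ∧ (s < 0 → u.1 a < u.1 c) ∧ (0 < s → u.1 c < u.1 a) :=
    fun s t => by
      obtain ⟨u, hu⟩ := exists_injRefinement h (Pi.single a s + Pi.single b t)
      have h1 := eq_of_cell_eq hab'
      have h2 := eq_of_cell_eq hbc'
      refine ⟨u, fun _ => hu a b h1 ?_, fun _ => hu b a h1.symm ?_, fun _ => hu b c h2 ?_,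
        fun _ => hu c b h2.symm ?_, fun _ => hu a c (h1.trans h2) ?_,
        fun _ => hu c a (h1.trans h2).symm ?_⟩ <;>
      simpa [Pi.single_apply, hab, hab.symm, hbc, hbc.symm, hac, hac.symm]
  -- In descending order, the four refinements order the class as `abc`, `bac`, `bca`, `cba`.
  obtain ⟨u₁, -, h1, -, h1', -, -⟩ := key 2 1
  obtain ⟨u₂, h2, -, -, h2', -, h2''⟩ := key 1 2
  obtain ⟨u₃, h3, -, -, h3', h3'', -⟩ := key (-1) 1
  obtain ⟨u₄, h4, -, h4', -, -, -⟩ := key (-2) (-1)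
  norm_num at h1 h1' h2 h2' h2'' h3 h3' h3'' h4 h4'
  have ha_mem : a ∈ B.cell h b := hab' ▸ self_mem_cell
  have hc_mem : c ∈ B.cell h b := hbc' ▸ self_mem_cell
  -- The cell of a lowest element of the class is the cell of `h`, and the cell of a middle element
  -- contains the elements above it to which it is linked.
  have hlow : ∀ (u : InjRefinement h) i, B.cell h i = B.cell h b → u.1 i ≤ u.1 a →
      u.1 i ≤ u.1 b → u.1 i ≤ u.1 c → B.cell h b ⊆ B.cell u.1 i := fun u i hi h1 h2 h3 => by
    rw [← hi]
    refine subset_cell_of_le u cell_mem self_mem_cell subset_rfl fun j _ hj => ?_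
    rcases H j (hj.trans hi) with rfl | rfl | rfl
    exacts [h1, h2, h3]
  have hb2 : b ∈ B.cell u₂.1 a := by
    refine subset_cell_of_le u₂ hK haK (hab' ▸ hKD) (fun j hj hj' => ?_) hbK
    rcases H j (hj'.trans hab') with rfl | rfl | rfl
    exacts [le_rfl, h2.le, absurd hj hcK]
  have hb3 : b ∈ B.cell u₃.1 c := by
    refine subset_cell_of_le u₃ hK' hcK' (hbc' ▸ hKD') (fun j hj hj' => ?_) hbK'
    rcases H j (hj'.trans hbc'.symm) with rfl | rfl | rfl
    exacts [absurd hj haK', h3'.le, le_rfl]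
  have hb3' : b ∈ B.cell u₃.1 a := hlow u₃ a hab' le_rfl h3.le h3''.le self_mem_cell
  have hb4 : b ∈ B.cell u₄.1 a :=
    hlow u₄ a hab' le_rfl h4.le (h4.trans h4').le self_mem_cell
  have ha2 : a ∈ B.cell u₂.1 c := hlow u₂ c hbc'.symm h2''.le h2'.le le_rfl ha_mem
  have hb2' : b ∈ B.cell u₂.1 c := hlow u₂ c hbc'.symm h2''.le h2'.le le_rfl self_mem_cell
  exact hP.four_le_vertexCount (hP.vertexOf_ne hb2 h1).symm (hP.vertexOf_ne hb3' h1).symm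
    (hP.vertexOf_ne hb4 h1).symm (hP.vertexOf_ne ha2 h3'') (hP.vertexOf_ne hb2' h4')
    (hP.vertexOf_ne hb3 h4')

/-- In the graphical case, a class with three elements gives at least four vertices. -/
theorem four_le_of_graph (hab : a ≠ b) (hbc : b ≠ c) (hac : a ≠ c)
    (hab' : B.cell h a = B.cell h b) (hbc' : B.cell h b = B.cell h c)
    (H : ∀ i, B.cell h i = B.cell h b → i = a ∨ i = b ∨ i = c)
    (hB : ∃ Γ : SimpleGraph S, B = graphicalBuilding Γ) : 4 ≤ hP.vertexCount h := by
  obtain ⟨Γ, rfl⟩ := hB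
  set B := graphicalBuilding Γ
  have hD : B.cell h b ∈ B.sets := cell_mem
  have ha : a ∈ B.cell h b := hab' ▸ self_mem_cell
  have hb : b ∈ B.cell h b := self_mem_cell
  have hc : c ∈ B.cell h b := hbc' ▸ self_mem_cell
  -- Each of the three elements is linked to another one, so two of the three pairs are linked.
  have h1 := linked_or_linked_of_graph Γ hD ha hb hab hac hbc
  have h2 := linked_or_linked_of_graph Γ hD hb hc hbc hab.symm hac.symm
  have h3 := linked_or_linked_of_graph Γ hD hc ha hac.symm hbc.symm hab
  have hcenter_a : B.Linked (B.cell h b) a b c → B.Linked (B.cell h b) a c b →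
      4 ≤ hP.vertexCount h := fun hL hL' =>
    hP.four_le_of_linked hab.symm hac hbc hab'.symm (hab'.trans hbc')
      (fun i hi => by rcases H i (hi.trans hab') with h | h | h <;> simp [h])
      (by rw [hab']; exact hL.symm) (by rw [hab']; exact hL')
  have hcenter_b : B.Linked (B.cell h b) a b c → B.Linked (B.cell h b) b c a →
      4 ≤ hP.vertexCount h := hP.four_le_of_linked hab hbc hac hab' hbc' H
  have hcenter_c : B.Linked (B.cell h b) a c b → B.Linked (B.cell h b) b c a →
      4 ≤ hP.vertexCount h := fun hL hL' =>
    hP.four_le_of_linked hac hbc.symm hab (hab'.trans hbc') hbc'.symm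
      (fun i hi => by rcases H i (hi.trans hbc'.symm) with h | h | h <;> simp [h])
      (by rw [← hbc']; exact hL) (by rw [← hbc']; exact hL'.symm)
  rcases h1 with h1 | h1
  · rcases h3 with h3 | h3
    · exact hcenter_a h1 h3.symm
    · exact hcenter_b h1 h3.symm
  · rcases h2 with h2 | h2
    · exact hcenter_c h1 h2
    · exact hcenter_a h2.symm h1

theorem vertexCount_bounds [Nonempty S]
    (hdim : Module.finrank ℝ (vectorSpan ℝ (maxFace P h)) = 2) :
    hP.vertexCount h ≤ 6 ∧
      ((∃ Γ : SimpleGraph S, B = graphicalBuilding Γ) → 4 ≤ hP.vertexCount h) := by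
  have h3 := (hP.isPolygon_maxFace hdim).2
  rcases hP.classes_of_finrank_eq_two hdim with
    ⟨a, b, H⟩ | ⟨a, b, c, d, hab, hcd, hab', hcd', hac, H⟩ | ⟨a, b, c, hab, hbc, hac, hab', hbc', H⟩
  · have := hP.vertexCount_le_two H
    omega
  · exact ⟨(hP.vertexCount_le_four H).trans (by norm_num),
      fun _ => hP.four_le_of_two_pairs hab hcd hab' hcd' hac H⟩
  · refine ⟨hP.vertexCount_le_six H,
      hP.four_le_of_graph hab hbc hac hab' hbc' fun i hi => ?_⟩
    by_cases hib : i = b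
    · exact Or.inr (Or.inl hib)
    · exact (H i b hi hib).1

end FacesMatchCells

end BuildingSet

theorem proposition6p4 {S : Type*} [Fintype S] [DecidableEq S] [Nonempty S] (B : BuildingSet S)
    (P : Set (S → ℝ)) (hP : P = B.nestedPolytope ∨ B.RealizesNestedFan P)
    (F : Set (S → ℝ)) (hF : IsTwoFace P F) :
    (∃ d : ℕ, d ∈ ({3, 4, 5, 6} : Set ℕ) ∧ IsPolygon d F) ∧
    ((∃ Γ : SimpleGraph S, B = graphicalBuilding Γ) →
      ∃ d : ℕ, d ∈ ({4, 5, 6} : Set ℕ) ∧ IsPolygon d F) := by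
  obtain ⟨hexp, hdim⟩ := hF
  have hne : F.Nonempty := by
    rw [Set.nonempty_iff_ne_empty]
    rintro rfl
    rw [vectorSpan_empty, finrank_bot] at hdim
    exact two_ne_zero hdim.symm
  have hP' : B.FacesMatchCells P := by
    rcases hP with rfl | hP
    · exact B.facesMatchCells_nestedPolytope
    · exact hP.facesMatchCells (hne.mono hexp.subset)
  obtain ⟨h, rfl⟩ := BuildingSet.exists_eq_maxFace hexp hne
  obtain ⟨hpoly, hge⟩ := hP'.isPolygon_maxFace hdim
  obtain ⟨hle, hgraph⟩ := hP'.vertexCount_bounds hdim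
  refine ⟨⟨_, ?_, hpoly⟩, fun hB => ⟨_, ?_, hpoly⟩⟩
  · simp only [Set.mem_insert_iff, Set.mem_singleton_iff]
    omega
  · have := hgraph hB
    simp only [Set.mem_insert_iff, Set.mem_singleton_iff]
    omega
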